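/- Let $1\le k\le n-1$ be integers, let $\mathbb S^n\subset\mathbb R^{n+1}$ be the unit sphere with surface measure $\mathrm dx$ and geodesic distance $d$, and let $0:=e_{n+1}\in\mathbb S^n$. Let $\Xi_k(\mathbb S^n)$ be the set of $k$-dimensional totally geodesic submanifolds $\xi=\mathbb S^n\cap V$, $V\subset\mathbb R^{n+1}$ a linear subspace with $\dim V=k+1$, with its rotation invariant measure; put $d(0,\xi)=\inf_{x\in\xi}d(0,x)$ and $R_kf(\xi)=\int_\xi f\,\mathrm d_\xi x$, where $\mathrm d_\xi x$ is the induced Riemannian measure on $\xi$. For $\alpha_1,\alpha_2\in\mathbb R$ let $L^{p,1}_{\alpha_1,\alpha_2}(\mathbb S^n)$ be the Lorentz space of measurable functions $f:\mathbb S^n\to\mathbb C$ with $$\|f\|_{L^{p,1}_{\alpha_1,\alpha_2}(\mathbb S^n)}=p\int_0^\infty \mu\{|f|>s\}^{1/p}\,\mathrm ds<\infty,\qquad \mathrm d\mu=\sin^{\alpha_1}d(0,x)\,|\cos d(0,x)|^{\alpha_2}\,\mathrm dx .$$ A function $f$ on $\mathbb S^n$ is radial if $f(x)=\tilde f(\cos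 d(0,x))$ for some $\tilde f:[-1,1]\to\mathbb C$. **Theorem.** Let $\alpha_1,\alpha_2,\gamma\in\mathbb R$ with $\alpha_1\ge k-n$ and $p=\frac{\alpha_1+n}{k}\ge 1+\alpha_2$, with strict inequality when $\alpha_2>0$. Consider the statement (E) there is a constant $C$, independent of $f$, such that for all radial $f\in L^{p,1}_{\alpha_1,\alpha_2}(\mathbb S^n)$ the transform $R_kf(\xi)$ exists (as an absolutely convergent integral) for almost every $\xi$ and $$\|\cos^\gamma d(0,\cdot)\,R_kf\|_{L^\infty(\Xi_k(\mathbb S^n))}\le C\,\|f\|_{L^{p,1}_{\alpha_1,\alpha_2}(\mathbb S^n)} .$$ (A) If $k\ge 2$, then (E) holds if and only if $\gamma\ge\frac{1+\alpha_2}{p}$. (B) If $k=1$, then (E) holds if and only if $\gamma\ge\frac{1+\alpha_2}{p}$ and $p\ge 2$. Both assertions also hold if in (E) only even radial functions ($f(-x)=f(x)$) are considered. -/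

import Mathlib

open MeasureTheory Set
open scoped ENNReal NNReal

noncomputable section

namespace SphereKPlane

/-! ### The sphere -/

/-- The Euclidean space `ℝⁿ⁺¹` that contains the sphere `𝕊ⁿ`. -/
abbrev Ambient (n : ℕ) : Type := EuclideanSpace ℝ (Fin (n + 1))

/-- The unit sphere `𝕊ⁿ` of `ℝⁿ⁺¹`. -/
abbrev Sph (n : ℕ) : Type := Metric.sphere (0 : Ambient n) 1

/-- The last standard unit vector `eₙ₊₁`, which is the origin `0` of `𝕊ⁿ`. -/
def northPole (n : ℕ) : Ambient n := EuclideanSpace.single (Fin.last n) 1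

/-- The geodesic distance `d(0, x)` on `𝕊ⁿ` from the origin: the angle between `eₙ₊₁` and `x`. -/
def dist0 {n : ℕ} (x : Sph n) : ℝ := InnerProductGeometry.angle (northPole n) (x : Ambient n)

/-- The Riemannian (surface) measure of `𝕊ⁿ`. -/
def sphereMeasure (n : ℕ) : Measure (Sph n) := (volume : Measure (Ambient n)).toSphere

/-- The measure `sin^α₁ d(0,x) |cos d(0,x)|^α₂ dx` on `𝕊ⁿ`. -/
def weightedMeasure (n : ℕ) (α₁ α₂ : ℝ) : Measure (Sph n) :=
  (sphereMeasure n).withDensity fun x =>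
    ENNReal.ofReal (Real.sin (dist0 x) ^ α₁ * |Real.cos (dist0 x)| ^ α₂)

/-- Radial functions on `𝕊ⁿ`: those of the form `f(x) = F(cos d(0,x))`. -/
def radialFunctions (n : ℕ) : Set (Sph n → ℂ) :=
  {f | ∃ F : ℝ → ℂ, ∀ x, f x = F (Real.cos (dist0 x))}

/-- Radial functions on `𝕊ⁿ` that are moreover even, `f(-x) = f(x)`. -/
def evenRadialFunctions (n : ℕ) : Set (Sph n → ℂ) :=
  {f | f ∈ radialFunctions n ∧ ∀ x, f (-x) = f x}

/-! ### Lorentz spaces -/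

/-- The distribution function `λ_f(s) = μ {x | |f x| > s}`. -/
def distribution {X : Type*} [MeasurableSpace X] (f : X → ℂ) (μ : Measure X) (s : ℝ) : ℝ≥0∞ :=
  μ {x | s < ‖f x‖}

/-- The Lorentz norm `‖f‖_{L^{p,q}(X,μ)} = p^{1/q} (∫₀^∞ (λ_f(s)^{1/p} s)^q ds/s)^{1/q}` for finite
`p, q`. -/
def lorentzNorm {X : Type*} [MeasurableSpace X] (f : X → ℂ) (p q : ℝ) (μ : Measure X) : ℝ≥0∞ :=
  ENNReal.ofReal p ^ (1 / q) *
    (∫⁻ s in Ioi (0 : ℝ),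
      (distribution f μ s ^ (1 / p) * ENNReal.ofReal s) ^ q / ENNReal.ofReal s) ^ (1 / q)

/-- Membership in the Lorentz space `L^{p,q}(X,μ)`. -/
def MemLorentz {X : Type*} [MeasurableSpace X] (f : X → ℂ) (p q : ℝ) (μ : Measure X) : Prop :=
  Measurable f ∧ lorentzNorm f p q μ < ∞

/-! ### Totally geodesic submanifolds and the `k`-plane transform -/

/-- `Ξ_k(𝕊ⁿ)`: a `k`-dimensional totally geodesic submanifold of `𝕊ⁿ` is the intersection of `𝕊ⁿ`
with a `(k+1)`-dimensional linear subspace, and it is represented by that subspace. -/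
def GeodesicSubsphere (n k : ℕ) : Type :=
  {V : Submodule ℝ (Ambient n) // Module.finrank ℝ V = k + 1}

namespace GeodesicSubsphere

variable {n k : ℕ}

/-- The set of points of `𝕊ⁿ` that lie on `ξ`. -/
def points (ξ : GeodesicSubsphere n k) : Set (Sph n) := {x | (x : Ambient n) ∈ ξ.1}

/-- The geodesic distance `d(0, ξ)` from the origin of `𝕊ⁿ` to `ξ`. -/
def dist0 (ξ : GeodesicSubsphere n k) : ℝ := sInf (SphereKPlane.dist0 '' ξ.points)

/-- The inclusion into `𝕊ⁿ` of `ξ`, seen as the unit sphere of its linear span. -/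
def incl (ξ : GeodesicSubsphere n k) (y : Metric.sphere (0 : ξ.1) 1) : Sph n :=
  ⟨((y : ξ.1) : Ambient n), by
    rw [mem_sphere_zero_iff_norm]
    exact mem_sphere_zero_iff_norm.1 y.2⟩

/-- The Riemannian measure `d_ξ x` that `ξ` inherits from `𝕊ⁿ`. -/
def measure (ξ : GeodesicSubsphere n k) : Measure (Metric.sphere (0 : ξ.1) 1) :=
  (volume : Measure ξ.1).toSphere

/-- The Borel sets of `Ξ_k(𝕊ⁿ)`, for the usual topology of the Grassmannian, in which a subspace is
identified with the orthogonal projection onto it. -/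
instance : MeasurableSpace (GeodesicSubsphere n k) :=
  (borel (Ambient n →L[ℝ] Ambient n)).comap fun ξ => ξ.1.starProjection

end GeodesicSubsphere

/-- The integral that defines `R_k f(ξ)` exists. -/
def KPlaneExists {n k : ℕ} (f : Sph n → ℂ) (ξ : GeodesicSubsphere n k) : Prop :=
  Integrable (fun y => f (ξ.incl y)) ξ.measure

/-- The `k`-plane transform `R_k f(ξ) = ∫_ξ f(x) d_ξ x`. -/
def kPlane {n k : ℕ} (f : Sph n → ℂ) (ξ : GeodesicSubsphere n k) : ℂ :=
  ∫ y, f (ξ.incl y) ∂ξ.measure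

/-! ### The invariant measure on `Ξ_k(𝕊ⁿ)` -/

/-- The special orthogonal group of `ℝⁿ`. -/
abbrev SO (n : ℕ) : Type := Matrix.specialOrthogonalGroup (Fin n) ℝ

instance (n : ℕ) : IsTopologicalGroup (SO n) where
  continuous_inv := by
    refine continuous_induced_rng.2 ?_
    exact (continuous_subtype_val (p := fun A => A ∈ Matrix.specialOrthogonalGroup (Fin n) ℝ)
      ).matrix_transpose

instance (n : ℕ) : CompactSpace (SO n) := by
  refine isCompact_iff_compactSpace.1 (?_ : IsCompact
    (Matrix.specialOrthogonalGroup (Fin n) ℝ : Set (Matrix (Fin n) (Fin n) ℝ)))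
  have hK : IsCompact {A : Matrix (Fin n) (Fin n) ℝ | ∀ i j, A i j ∈ Icc (-1 : ℝ) 1} := by
    have : {A : Matrix (Fin n) (Fin n) ℝ | ∀ i j, A i j ∈ Icc (-1 : ℝ) 1} =
        univ.pi fun _ : Fin n => univ.pi fun _ : Fin n => Icc (-1 : ℝ) 1 := by
      ext A
      exact ⟨fun hA i _ j _ => hA i j, fun hA i j => hA i trivial j trivial⟩
    rw [this]
    exact isCompact_univ_pi fun _ => isCompact_univ_pi fun _ => isCompact_Icc
  have hset : (Matrix.specialOrthogonalGroup (Fin n) ℝ : Set (Matrix (Fin n) (Fin n) ℝ)) =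
      {A | A * A.transpose = 1} ∩ {A | A.det = 1} := by
    ext A
    rw [SetLike.mem_coe, Matrix.mem_specialOrthogonalGroup_iff, Matrix.mem_orthogonalGroup_iff]
    rfl
  refine hK.of_isClosed_subset ?_ ?_
  · rw [hset]
    exact (isClosed_eq (by fun_prop) continuous_const).inter
      (isClosed_eq (by fun_prop) continuous_const)
  · intro A hA i j
    rw [hset] at hA
    have h1 : ∑ l, A i l * A i l = 1 := by
      have := congrFun (congrFun hA.1 i) i
      simpa [Matrix.mul_apply] using this
    have h2 : A i j * A i j ≤ 1 := by
      rw [← h1]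
      exact Finset.single_le_sum (f := fun l => A i l * A i l)
        (fun l _ => mul_self_nonneg _) (Finset.mem_univ j)
    constructor <;> nlinarith

instance (n : ℕ) : MeasurableSpace (SO n) := borel _

instance (n : ℕ) : BorelSpace (SO n) := ⟨rfl⟩

/-- The Haar measure of `SO(n)`, of total mass one. -/
def haarSO (n : ℕ) : Measure (SO n) := Measure.haarMeasure ⊤

/-- The vector `g • e_i` of `ℝⁿ`, placed in `ℝⁿ⁺¹ = ℝⁿ × ℝ eₙ₊₁`. -/
def rotVec {n : ℕ} (g : SO n) (i : Fin n) : Ambient n :=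
  WithLp.toLp 2 (Fin.snoc (α := fun _ => ℝ) (fun j => g.1 j i) 0)

/-- The point `exp_0(h g • e_{k+1})` of `𝕊ⁿ`, followed by the orthonormal system
`g • e_1, …, g • e_k` of directions that are orthogonal to it. -/
def frame {n k : ℕ} (hk : k < n) (g : SO n) (h : ℝ) : Fin (k + 1) → Ambient n :=
  Fin.cons (Real.cos h • northPole n + Real.sin h • rotVec g ⟨k, hk⟩)
    fun i : Fin k => rotVec g ⟨i, i.2.trans hk⟩

theorem inner_rotVec {n : ℕ} (g : SO n) (i j : Fin n) :
    inner ℝ (rotVec g i) (rotVec g j) = if i = j then 1 else 0 := by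
  have hg : g.1.transpose * g.1 = 1 :=
    (Matrix.mem_orthogonalGroup_iff' _ _).1 (Matrix.mem_specialOrthogonalGroup_iff.1 g.2).1
  have := congrFun (congrFun hg i) j
  rw [Matrix.mul_apply, Matrix.one_apply] at this
  rw [← this]
  simp [rotVec, PiLp.inner_apply, Fin.sum_univ_castSucc, mul_comm]

theorem inner_northPole_rotVec {n : ℕ} (g : SO n) (i : Fin n) :
    inner ℝ (northPole n) (rotVec g i) = 0 := by
  rw [northPole, EuclideanSpace.inner_single_left]
  simp [rotVec]

theorem inner_northPole_self (n : ℕ) : inner ℝ (northPole n) (northPole n) = 1 := by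
  simp [northPole]

theorem frame_orthonormal {n k : ℕ} (hk : k < n) (g : SO n) (h : ℝ) :
    Orthonormal ℝ (frame hk g h) := by
  have hs := Real.cos_sq_add_sin_sq h
  rw [orthonormal_iff_ite]
  intro i j
  refine Fin.cases ?_ (fun i => ?_) i <;> refine Fin.cases ?_ (fun j => ?_) j
  · simp only [frame, Fin.cons_zero, inner_add_left, inner_add_right, inner_smul_left,
      inner_smul_right, inner_rotVec, inner_northPole_rotVec, inner_northPole_self,
      real_inner_comm (northPole n) (rotVec g _), if_true]
    simp
    linarith
  · have : k ≠ (j : ℕ) := j.2.ne'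
    simp [frame, inner_add_left, inner_smul_left,
      inner_rotVec, inner_northPole_rotVec, this, (Fin.succ_ne_zero _).symm]
  · have : (i : ℕ) ≠ k := i.2.ne
    simp [frame, inner_add_right, inner_smul_right, real_inner_comm (northPole n) (rotVec g _),
      inner_rotVec, inner_northPole_rotVec, this]
  · simp [frame, inner_rotVec, Fin.ext_iff]

/-- The submanifold `(g • ℝ^k, h g • e_{k+1})`: the totally geodesic submanifold through
`exp_0(h g • e_{k+1})` with the directions `g • ℝ^k`. -/
def param {n k : ℕ} (hk : k < n) (x : SO n × ℝ) : GeodesicSubsphere n k :=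
  ⟨Submodule.span ℝ (range (frame hk x.1 x.2)), by
    simpa using finrank_span_eq_card (frame_orthonormal hk x.1 x.2).linearIndependent⟩

theorem measurable_param {n k : ℕ} (hk : k < n) : Measurable (param hk) := by
  have hr : ∀ i : Fin n, Continuous fun x : SO n × ℝ => rotVec x.1 i := by
    intro i
    unfold rotVec
    refine (PiLp.continuous_toLp 2 _).comp (continuous_pi fun j => ?_)
    refine Fin.lastCases ?_ (fun j => ?_) j
    · simpa using continuous_const
    · simpa using (continuous_subtype_val.comp continuous_fst).matrix_elem j i
  have hf : ∀ i, Continuous fun x : SO n × ℝ => frame hk x.1 x.2 i := by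
    intro i
    refine Fin.cases ?_ (fun i => ?_) i
    · simp only [frame, Fin.cons_zero]
      exact ((Real.continuous_cos.comp continuous_snd).smul continuous_const).add
        ((Real.continuous_sin.comp continuous_snd).smul (hr _))
    · simpa only [frame, Fin.cons_succ] using hr _
  have hP : ∀ x : SO n × ℝ, (param hk x).1.starProjection =
      ∑ i, InnerProductSpace.rankOne ℝ (frame hk x.1 x.2 i) (frame hk x.1 x.2 i) := by
    intro x
    have ho := frame_orthonormal hk x.1 x.2
    let b₀ := Module.Basis.span ho.linearIndependent
    have hb₀ : ∀ i, (b₀ i : Ambient n) = frame hk x.1 x.2 i := fun i =>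
      congrArg Subtype.val (Module.Basis.span_apply ho.linearIndependent i)
    let b := b₀.toOrthonormalBasis (by
      rw [orthonormal_iff_ite] at ho ⊢
      intro i j
      rw [Submodule.coe_inner, hb₀, hb₀]
      exact ho i j)
    have hb : ∀ i, (b i : Ambient n) = frame hk x.1 x.2 i := fun i => by simp [b, hb₀]
    have := b.starProjection_eq_sum_rankOne
    simp only [hb] at this
    exact this
  rw [measurable_comap_iff]
  borelize (Ambient n →L[ℝ] Ambient n)
  refine Continuous.measurable ?_
  simp only [Function.comp_def, hP]
  refine continuous_finsetSum _ fun i _ => ?_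
  have h1 : Continuous fun v : Ambient n => InnerProductSpace.rankOne (F := Ambient n) ℝ v :=
    (InnerProductSpace.rankOne ℝ).continuous
  exact (h1.comp (hf i)).clm_apply (hf i)

/-- The rotation invariant measure on `Ξ_k(𝕊ⁿ)`, up to a normalizing constant:
`∫ φ dξ = ∫_{SO(n)} ∫_0^{π/2} φ(g • ℝ^k, h g • e_{k+1}) sin^{n-k-1} h cos^k h dh dg`. -/
def grassmannMeasure {n k : ℕ} (hk : k < n) : Measure (GeodesicSubsphere n k) :=
  ((haarSO n).prod ((volume.restrict (Ioo 0 (Real.pi / 2))).withDensity fun h =>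
    ENNReal.ofReal (Real.sin h ^ (n - k - 1) * Real.cos h ^ k))).map (param hk)

/-- The endpoint estimate on a class `𝒞` of functions: there is a constant `C`, independent of `f`,
such that for all `f ∈ 𝒞 ∩ L^{p,1}_{α₁,α₂}(𝕊ⁿ)` the transform `R_k f` exists almost everywhere and
`‖cos^γ d(0,·) R_k f‖_{L^∞(Ξ_k(𝕊ⁿ))} ≤ C ‖f‖_{L^{p,1}_{α₁,α₂}(𝕊ⁿ)}`. -/
def EndpointEstimate {n k : ℕ} (hk : k < n) (𝒞 : Set (Sph n → ℂ)) (α₁ α₂ p γ : ℝ) : Prop :=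
  ∃ C : ℝ≥0, ∀ f ∈ 𝒞, MemLorentz f p 1 (weightedMeasure n α₁ α₂) →
    (∀ᵐ ξ ∂grassmannMeasure hk, KPlaneExists f ξ) ∧
      eLpNorm (fun ξ => ((Real.cos ξ.dist0 ^ γ : ℝ) : ℂ) * kPlane f ξ) ∞ (grassmannMeasure hk) ≤
        C * lorentzNorm f p 1 (weightedMeasure n α₁ α₂)

end SphereKPlane

end

noncomputable section

namespace SphereKPlane

/-! For radial `f(x) = F(cos d(0,x))` everything becomes one-dimensional. With `a = cos d(0,ξ)`, the
length of the projection of the pole to the span of `ξ`, slicing the unit sphere of that span gives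
`R_k f(ξ) = c ∫ F(au) dν(u)`, where `dν = (1-u²)^(k/2-1) du` on `(-1,1)`. The same slicing
(`lintegral_toSphere_inner`) turns the weighted measure into `|t|^α₂ (1-t²)^(kp/2-1) dt`, because
`α₁ + n = kp`.

Sufficiency rests on `ν(E)^p ≤ K ∫_E |u|^α₂ (1-u²)^(kp/2-1) du` (`levelMeasure_rpow_le`). With `g =
|u| (1-u²)^(k/2)`, the right-hand density relative to `ν` is at least `g^(p-1)`, since `α₂ ≤ p-1`.
Moreover `ν{g ≤ r} ≤ K r`, so a set of given `ν`-mass cannot concentrate where `g` is small. The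
dilation `t = au` then costs `a^(-(1+α₂))` and uses `1-u² ≤ 1-(au)²`, which points the right way
when `kp ≥ 2`. Taking `p`-th roots and integrating over the levels of `|f|` gives the `L^{p,1}`
bound with factor `a^(-(1+α₂)/p)`, absorbed by `a^γ`.

Necessity comes from indicators of symmetric annuli in `t`. Annuli at scale `δ → 0` with `a`
comparable to `δ` force the bound on `γ`. For `k = 1`, annuli of width `ε` with outer radius `1/2`
and `a` slightly above `1/2` have `ν`-mass at least a constant times `ε^(1/2)`, which forces `1/p ≤
1/2`. -/

/-! ### Polar coordinates, and slicing a sphere by a linear functional. -/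

theorem lintegral_eq_lintegral_toSphere {E : Type*} [NormedAddCommGroup E] [NormedSpace ℝ E]
    [MeasurableSpace E] [BorelSpace E] [FiniteDimensional ℝ E] [Nontrivial E] (μ : Measure E)
    [μ.IsAddHaarMeasure] {φ : E → ℝ≥0∞} (hφ : Measurable φ) :
    ∫⁻ x, φ x ∂μ = ∫⁻ y : Metric.sphere (0 : E) 1, (∫⁻ r in Ioi (0 : ℝ),
      ENNReal.ofReal (r ^ (Module.finrank ℝ E - 1)) * φ (r • (y : E))) ∂μ.toSphere := by
  have hmp := μ.measurePreserving_homeomorphUnitSphereProd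
  have hm : Measurable fun z : Metric.sphere (0 : E) 1 × Ioi (0 : ℝ) =>
      φ ((z.2 : ℝ) • (z.1 : E)) := by fun_prop
  calc ∫⁻ x, φ x ∂μ = ∫⁻ x in ({0}ᶜ : Set E), φ x ∂μ := by rw [restrict_compl_singleton]
    _ = ∫⁻ x : ({0}ᶜ : Set E), φ x ∂(μ.comap (↑)) :=
      (lintegral_subtype_comap (measurableSet_singleton _).compl φ).symm
    _ = ∫⁻ z, φ ((z.2 : ℝ) • (z.1 : E)) ∂(μ.toSphere.prod
          (.volumeIoiPow (Module.finrank ℝ E - 1))) := by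
      rw [← hmp.lintegral_comp hm]
      refine lintegral_congr fun x => ?_
      have hx : ‖(x : E)‖ ≠ 0 := norm_ne_zero_iff.2 x.2
      simp [smul_smul, hx]
    _ = _ := by
      rw [lintegral_prod _ hm.aemeasurable]
      refine lintegral_congr fun y => ?_
      rw [Measure.volumeIoiPow, lintegral_withDensity_eq_lintegral_mul _ (by fun_prop)
        (by fun_prop), ← lintegral_subtype_comap measurableSet_Ioi]
      rfl

theorem lintegral_fun_norm_eq {E : Type*} [NormedAddCommGroup E] [NormedSpace ℝ E]
    [MeasurableSpace E] [BorelSpace E] [FiniteDimensional ℝ E] [Nontrivial E] (μ : Measure E)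
    [μ.IsAddHaarMeasure] {φ : ℝ → ℝ≥0∞} (hφ : Measurable φ) :
    ∫⁻ x, φ ‖x‖ ∂μ = μ.toSphere univ *
      ∫⁻ r in Ioi (0 : ℝ), ENNReal.ofReal (r ^ (Module.finrank ℝ E - 1)) * φ r := by
  rw [lintegral_eq_lintegral_toSphere μ (φ := fun x => φ ‖x‖) (by fun_prop), mul_comm,
    ← lintegral_const]
  refine lintegral_congr fun y => setLIntegral_congr_fun measurableSet_Ioi fun r hr => ?_
  simp [norm_smul, abs_of_pos (mem_Ioi.1 hr)]

theorem lintegral_orthonormalBasis_split {E : Type*} [NormedAddCommGroup E]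
    [InnerProductSpace ℝ E] [FiniteDimensional ℝ E] [MeasurableSpace E] [BorelSpace E] {m : ℕ}
    (hE : Module.finrank ℝ E = m + 1) {e : E} (he : ‖e‖ = 1) {Φ : ℝ × ℝ → ℝ≥0∞}
    (hΦ : Measurable Φ) :
    ∫⁻ x : E, Φ (inner ℝ e x, ‖x‖) =
      ∫⁻ t : ℝ, ∫⁻ z : EuclideanSpace ℝ (Fin m), Φ (t, √(t ^ 2 + ‖z‖ ^ 2)) := by
  obtain ⟨b, hb⟩ := Orthonormal.exists_orthonormalBasis_extension_of_card_eq
    (𝕜 := ℝ) (E := E) (ι := Fin (m + 1)) (by simp [hE]) (v := fun _ => e) (s := {0}) (by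
      rw [orthonormal_iff_ite]
      rintro ⟨i, hi⟩ ⟨j, hj⟩
      simp only [mem_singleton_iff] at hi hj
      subst hi hj
      simp [he])
  have hb0 : b 0 = e := hb 0 rfl
  have h1 := b.measurePreserving_repr
  have h2 := (EuclideanSpace.volume_preserving_symm_measurableEquiv_toLp (Fin (m + 1)))
  have h3 := volume_preserving_piFinSuccAbove (fun _ : Fin (m + 1) => ℝ) 0
  have h4 : MeasurePreserving (fun w : Fin m → ℝ => (WithLp.toLp 2 w : EuclideanSpace ℝ (Fin m))) :=
    PiLp.volume_preserving_toLp (Fin m)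
  have h5 := ((MeasurePreserving.id (volume : Measure ℝ)).prod h4).comp (h3.comp (h2.comp h1))
  have hm : Measurable fun z : ℝ × EuclideanSpace ℝ (Fin m) =>
      Φ (z.1, √(z.1 ^ 2 + ‖z.2‖ ^ 2)) := by fun_prop
  rw [← lintegral_prod (f := fun z : ℝ × EuclideanSpace ℝ (Fin m) =>
      Φ (z.1, √(z.1 ^ 2 + ‖z.2‖ ^ 2))) hm.aemeasurable]
  erw [← h5.lintegral_comp hm]
  refine lintegral_congr fun x => ?_
  have hx : ‖x‖ ^ 2 = (inner ℝ e x) ^ 2 + ∑ i : Fin m, (inner ℝ (b i.succ) x) ^ 2 := by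
    rw [← b.sum_sq_norm_inner_right, Fin.sum_univ_succ, hb0]
    simp
  congr 1
  ext
  · simp [MeasurableEquiv.piFinSuccAbove, OrthonormalBasis.repr_apply_apply, hb0]
  · simp only [EuclideanSpace.norm_sq_eq]
    rw [← Real.sqrt_sq (norm_nonneg x), hx]
    simp [MeasurableEquiv.piFinSuccAbove, OrthonormalBasis.repr_apply_apply, hb0,
      Fin.insertNthEquiv, Fin.tail]

theorem lintegral_upperHalfPlane_polarCoord {H : ℝ × ℝ → ℝ≥0∞} (hH : Measurable H) :
    ∫⁻ t : ℝ, ∫⁻ ρ in Ioi (0 : ℝ), H (t, ρ) =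
      ∫⁻ r in Ioi (0 : ℝ), ∫⁻ θ in Ioo 0 Real.pi,
        ENNReal.ofReal r * H (r * Real.cos θ, r * Real.sin θ) := by
  have hS : MeasurableSet {z : ℝ × ℝ | 0 < z.2} := measurableSet_lt measurable_const measurable_snd
  have hG : Measurable ({z : ℝ × ℝ | 0 < z.2}.indicator H) := hH.indicator hS
  have e1 : ∫⁻ t : ℝ, ∫⁻ ρ in Ioi (0 : ℝ), H (t, ρ) =
      ∫⁻ z, {z : ℝ × ℝ | 0 < z.2}.indicator H z := by
    rw [Measure.volume_eq_prod, lintegral_prod _ hG.aemeasurable]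
    refine lintegral_congr fun t => ?_
    rw [← lintegral_indicator measurableSet_Ioi]
    rfl
  rw [e1, ← lintegral_comp_polarCoord_symm, polarCoord_target, Measure.volume_eq_prod,
    ← Measure.prod_restrict, lintegral_prod]
  · refine setLIntegral_congr_fun measurableSet_Ioi fun r hr => ?_
    have hr : 0 < r := hr
    rw [← lintegral_indicator measurableSet_Ioo, ← lintegral_indicator measurableSet_Ioo]
    refine lintegral_congr fun θ => ?_
    by_cases h1 : θ ∈ Ioo (-Real.pi) Real.pi
    · by_cases h2 : 0 < θ
      · have h3 : θ ∈ Ioo 0 Real.pi := ⟨h2, h1.2⟩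
        have := Real.sin_pos_of_mem_Ioo h3
        simp [h1.1, h1.2, h2, indicator, polarCoord_symm_apply, hr, this]
      · have := Real.sin_nonpos_of_nonpos_of_neg_pi_le (not_lt.1 h2) h1.1.le
        have : ¬ 0 < r * Real.sin θ := not_lt.2 (mul_nonpos_of_nonneg_of_nonpos hr.le this)
        simp [h2, indicator, polarCoord_symm_apply, this]
    · have h3 : θ ∉ Ioo 0 Real.pi := fun h => h1 ⟨by linarith [h.1, Real.pi_pos], h.2⟩
      rw [indicator_of_notMem h1, indicator_of_notMem h3]
  · refine Measurable.aemeasurable ?_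
    have : Measurable fun z : ℝ × ℝ => polarCoord.symm z := by
      simp only [polarCoord_symm_apply]
      fun_prop
    exact (measurable_fst.ennreal_ofReal).smul (hG.comp this)

/-- Substitute `u = cos θ`: one factor `sin θ` is the Jacobian and the remaining `sin^(m-2) θ` is
`(1-u²)^(m/2-1)`. For `m = 1` this exponent is negative, hence the real power. -/
theorem lintegral_Ioo_pi_comp_cos (m : ℕ) (hm : 1 ≤ m) (φ : ℝ → ℝ≥0∞) :
    ∫⁻ θ in Ioo 0 Real.pi, ENNReal.ofReal (Real.sin θ ^ (m - 1)) * φ (Real.cos θ) =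
      ∫⁻ u in Ioo (-1 : ℝ) 1, ENNReal.ofReal ((1 - u ^ 2) ^ ((m : ℝ) / 2 - 1)) * φ u := by
  have himg : Real.cos '' Ioo 0 Real.pi = Ioo (-1) 1 := by
    simpa using Real.cosPartialHomeomorph.image_source_eq_target
  rw [← himg, lintegral_image_eq_lintegral_abs_deriv_mul measurableSet_Ioo
    (fun θ _ => (Real.hasDerivAt_cos θ).hasDerivWithinAt)
    (Real.injOn_cos.mono Ioo_subset_Icc_self)]
  refine setLIntegral_congr_fun measurableSet_Ioo fun θ hθ => ?_
  have hs := Real.sin_pos_of_mem_Ioo hθ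
  rw [← mul_assoc, ← ENNReal.ofReal_mul (abs_nonneg _), abs_neg, abs_of_pos hs]
  congr 2
  rw [← Real.sin_sq, ← Real.rpow_natCast, ← Real.rpow_natCast (n := 2), ← Real.rpow_mul hs.le]
  nth_rewrite 2 [← Real.rpow_one (Real.sin θ)]
  rw [← Real.rpow_add hs]
  congr 1
  push_cast [hm]
  ring

/-- The surface measure of the unit sphere of `ℝᵐ`. -/
def sphereConst (m : ℕ) : ℝ≥0∞ := (volume : Measure (EuclideanSpace ℝ (Fin m))).toSphere univ

theorem sphereConst_ne_top (m : ℕ) : sphereConst m ≠ ∞ := measure_ne_top _ _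

theorem sphereConst_ne_zero {m : ℕ} (hm : 1 ≤ m) : sphereConst m ≠ 0 := by
  have : Nonempty (Fin m) := ⟨⟨0, hm⟩⟩
  rw [sphereConst, Ne, Measure.measure_univ_eq_zero]
  exact Measure.toSphere_ne_zero _

/-- The surface measure of a sphere, disintegrated along the levels of a linear functional. -/
theorem lintegral_toSphere_inner {E : Type*} [NormedAddCommGroup E]
    [InnerProductSpace ℝ E] [FiniteDimensional ℝ E] [MeasurableSpace E] [BorelSpace E] {m : ℕ}
    (hm : 1 ≤ m) (hE : Module.finrank ℝ E = m + 1) {e : E} (he : ‖e‖ = 1) {φ : ℝ → ℝ≥0∞}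
    (hφ : Measurable φ) :
    ∫⁻ y : Metric.sphere (0 : E) 1, φ (inner ℝ e (y : E)) ∂(volume : Measure E).toSphere =
      sphereConst m *
        ∫⁻ u in Ioo (-1 : ℝ) 1, ENNReal.ofReal ((1 - u ^ 2) ^ ((m : ℝ) / 2 - 1)) * φ u := by
  have : Nontrivial E := Module.nontrivial_of_finrank_pos (R := ℝ) (by omega)
  have : Nonempty (Fin m) := ⟨⟨0, hm⟩⟩
  -- The integral of `φ(⟨e,x⟩/‖x‖)` over the open unit ball is computed twice: in polar coordinates
  -- of `E`, and by splitting off the direction `e` and using polar coordinates in the half-plane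
  -- `(t, ρ)`. Both results carry the radial factor `K`, which is cancelled and so must be neither
  -- `0` nor `∞`.
  set K : ℝ≥0∞ := ∫⁻ r in Ioi (0 : ℝ), ENNReal.ofReal (r ^ m) * (Iio 1).indicator 1 r with hK
  have hK' : K = ∫⁻ r in Ioo (0 : ℝ) 1, ENNReal.ofReal (r ^ m) := by
    rw [hK, ← lintegral_indicator measurableSet_Ioi, ← lintegral_indicator measurableSet_Ioo]
    refine lintegral_congr fun r => ?_
    by_cases h1 : 0 < r <;> by_cases h2 : r < 1 <;> simp [indicator, h1, h2]
  have hK0 : K ≠ 0 := by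
    rw [hK', Ne, lintegral_eq_zero_iff (by fun_prop)]
    intro h
    have h2 : ∀ᵐ r ∂volume.restrict (Ioo (0 : ℝ) 1), False := by
      filter_upwards [h, ae_restrict_mem measurableSet_Ioo] with r hr hr2
      have := pow_pos hr2.1 m
      simp at hr
      linarith
    have hne : (ae (volume.restrict (Ioo (0 : ℝ) 1))).NeBot := by
      rw [ae_neBot, Ne, Measure.restrict_eq_zero]
      simp
    exact h2.exists.choose_spec
  have hKt : K ≠ ∞ := by
    rw [hK']
    refine (lt_of_le_of_lt (setLIntegral_mono' (g := fun _ => 1) measurableSet_Ioo ?_) ?_).ne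
    · intro r hr
      exact ENNReal.ofReal_le_one.2 (pow_le_one₀ hr.1.le hr.2.le)
    · simp
  let Φ : ℝ × ℝ → ℝ≥0∞ := fun z => (Iio (1 : ℝ)).indicator 1 z.2 * φ (z.1 / z.2)
  have hi : Measurable ((Iio (1 : ℝ)).indicator (1 : ℝ → ℝ≥0∞)) :=
    measurable_one.indicator measurableSet_Iio
  have hΦ : Measurable Φ := by fun_prop
  have h1 : ∫⁻ x : E, Φ (inner ℝ e x, ‖x‖) =
      (∫⁻ y : Metric.sphere (0 : E) 1, φ (inner ℝ e (y : E)) ∂(volume : Measure E).toSphere) *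
        K := by
    rw [lintegral_eq_lintegral_toSphere volume (φ := fun x => Φ (inner ℝ e x, ‖x‖)) (by fun_prop),
      ← lintegral_mul_const _ (by fun_prop)]
    refine lintegral_congr fun y => ?_
    rw [hK, ← lintegral_const_mul _ (by fun_prop)]
    refine setLIntegral_congr_fun measurableSet_Ioi fun r hr => ?_
    have hr : 0 < r := hr
    simp only [Φ, norm_smul, inner_smul_right, hE, norm_eq_of_mem_sphere y, Real.norm_eq_abs,
      abs_of_pos hr, mul_one, Nat.add_sub_cancel, mul_div_cancel_left₀ _ hr.ne']
    ring
  have h2 : ∫⁻ x : E, Φ (inner ℝ e x, ‖x‖) = sphereConst m * ((∫⁻ u in Ioo (-1 : ℝ) 1,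
      ENNReal.ofReal ((1 - u ^ 2) ^ ((m : ℝ) / 2 - 1)) * φ u) * K) := by
    let H : ℝ × ℝ → ℝ≥0∞ := fun z =>
      ENNReal.ofReal (z.2 ^ (m - 1)) * Φ (z.1, √(z.1 ^ 2 + z.2 ^ 2))
    have hH : Measurable H := by fun_prop
    have e1 : ∀ t : ℝ, ∫⁻ z : EuclideanSpace ℝ (Fin m), Φ (t, √(t ^ 2 + ‖z‖ ^ 2)) =
        sphereConst m * ∫⁻ ρ in Ioi (0 : ℝ), H (t, ρ) := by
      intro t
      rw [lintegral_fun_norm_eq volume (φ := fun ρ => Φ (t, √(t ^ 2 + ρ ^ 2))) (by fun_prop)]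
      simp [sphereConst, H]
    rw [lintegral_orthonormalBasis_split hE he hΦ]
    simp only [e1]
    rw [lintegral_const_mul _ (hH.lintegral_prod_right' (ν := volume.restrict (Ioi 0))),
      lintegral_upperHalfPlane_polarCoord hH, ← lintegral_Ioo_pi_comp_cos m hm]
    congr 1
    rw [hK, ← lintegral_const_mul _ (by fun_prop)]
    refine setLIntegral_congr_fun measurableSet_Ioi fun r hr => ?_
    have hr : 0 < r := hr
    rw [← lintegral_mul_const _ (by fun_prop)]
    refine setLIntegral_congr_fun measurableSet_Ioo fun θ hθ => ?_
    have hs := Real.sin_pos_of_mem_Ioo hθ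
    have e2 : √((r * Real.cos θ) ^ 2 + (r * Real.sin θ) ^ 2) = r := by
      rw [mul_pow, mul_pow, ← mul_add, Real.cos_sq_add_sin_sq, mul_one, Real.sqrt_sq hr.le]
    simp only [H, Φ, e2, mul_div_cancel_left₀ _ hr.ne']
    have e3 : r ^ m = r * r ^ (m - 1) := by rw [← pow_succ', Nat.sub_add_cancel hm]
    rw [e3, mul_pow, ENNReal.ofReal_mul hr.le, ENNReal.ofReal_mul (by positivity)]
    ring
  rw [h1, ← mul_assoc] at h2
  exact (ENNReal.mul_left_inj hK0 hKt).1 h2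

/-! ### The weighted measure in the variable `t = cos d(0,x)`. -/

theorem norm_northPole (n : ℕ) : ‖northPole n‖ = 1 := by simp [northPole]

theorem dist0_eq_arccos {n : ℕ} (x : Sph n) :
    dist0 x = Real.arccos (inner ℝ (northPole n) (x : Ambient n)) := by
  rw [dist0, InnerProductGeometry.angle, norm_northPole, norm_eq_of_mem_sphere x]
  simp

theorem abs_inner_northPole_le {n : ℕ} (x : Sph n) :
    |inner ℝ (northPole n) (x : Ambient n)| ≤ 1 := by
  simpa [norm_northPole, norm_eq_of_mem_sphere x] using
    abs_real_inner_le_norm (northPole n) (x : Ambient n)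

theorem cos_dist0 {n : ℕ} (x : Sph n) :
    Real.cos (dist0 x) = inner ℝ (northPole n) (x : Ambient n) := by
  have := abs_le.1 (abs_inner_northPole_le x)
  rw [dist0_eq_arccos, Real.cos_arccos this.1 this.2]

theorem sin_dist0 {n : ℕ} (x : Sph n) :
    Real.sin (dist0 x) = √(1 - Real.cos (dist0 x) ^ 2) := by
  rw [cos_dist0, dist0_eq_arccos, Real.sin_arccos]

theorem cos_dist0_mem_Icc {n : ℕ} (x : Sph n) : Real.cos (dist0 x) ∈ Icc (-1 : ℝ) 1 :=
  ⟨Real.neg_one_le_cos _, Real.cos_le_one _⟩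

theorem measurable_cos_dist0 (n : ℕ) : Measurable fun x : Sph n => Real.cos (dist0 x) := by
  simp only [cos_dist0]
  fun_prop

/-- A meridian, parametrized by the cosine of the distance to the origin. -/
theorem exists_measurable_section {n : ℕ} (hn : 0 < n) :
    ∃ s : ℝ → Sph n, Measurable s ∧ ∀ t ∈ Icc (-1 : ℝ) 1, Real.cos (dist0 (s t)) = t := by
  let e : Ambient n := EuclideanSpace.single 0 1
  have he : ‖e‖ = 1 := by simp [e]
  have h0 : inner ℝ (northPole n) e = 0 := by
    have : Fin.last n ≠ 0 := by simp [Fin.ext_iff, hn.ne']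
    rw [northPole, EuclideanSpace.inner_single_left]
    simp [e, this]
  let c : ℝ → Ambient n := fun t =>
    Real.cos (Real.arccos t) • northPole n + Real.sin (Real.arccos t) • e
  have hc : ∀ t, ‖c t‖ = 1 := by
    intro t
    have : ‖c t‖ ^ 2 = 1 := by
      simp only [c]
      rw [norm_add_sq_real, norm_smul, norm_smul, inner_smul_left, inner_smul_right, h0, he,
        norm_northPole]
      simp only [mul_one, mul_zero, add_zero, Real.norm_eq_abs, sq_abs]
      exact Real.cos_sq_add_sin_sq _
    nlinarith [norm_nonneg (c t)]
  refine ⟨fun t => ⟨c t, mem_sphere_zero_iff_norm.2 (hc t)⟩, ?_, fun t ht => ?_⟩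
  · refine Measurable.subtype_mk (Continuous.measurable ?_)
    have := Real.continuous_arccos
    fun_prop
  · rw [cos_dist0]
    simp only [c, inner_add_right, inner_smul_right, h0, inner_northPole_self,
      Real.cos_arccos ht.1 ht.2]
    simp

theorem lintegral_sphereMeasure_cos {n : ℕ} (hn : 1 ≤ n) {φ : ℝ → ℝ≥0∞} (hφ : Measurable φ) :
    ∫⁻ x, φ (Real.cos (dist0 x)) ∂sphereMeasure n = sphereConst n *
      ∫⁻ u in Ioo (-1 : ℝ) 1, ENNReal.ofReal ((1 - u ^ 2) ^ ((n : ℝ) / 2 - 1)) * φ u := by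
  simp only [cos_dist0]
  exact lintegral_toSphere_inner hn (by simp) (norm_northPole n) hφ

theorem weightedMeasure_cos_mem {n : ℕ} (hn : 1 ≤ n) (α₁ α₂ : ℝ) {A : Set ℝ}
    (hA : MeasurableSet A) :
    weightedMeasure n α₁ α₂ {x | Real.cos (dist0 x) ∈ A} = sphereConst n *
      ∫⁻ t in Ioo (-1 : ℝ) 1 ∩ A,
        ENNReal.ofReal (|t| ^ α₂ * (1 - t ^ 2) ^ ((α₁ + n) / 2 - 1)) := by
  have hS : MeasurableSet {x : Sph n | Real.cos (dist0 x) ∈ A} := measurable_cos_dist0 n hA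
  let φ : ℝ → ℝ≥0∞ := A.indicator fun t => ENNReal.ofReal (√(1 - t ^ 2) ^ α₁ * |t| ^ α₂)
  have hφ : Measurable φ := Measurable.indicator (by fun_prop) hA
  have h1 := lintegral_sphereMeasure_cos hn hφ
  rw [weightedMeasure, withDensity_apply _ hS, ← lintegral_indicator hS]
  convert h1 using 2
  · ext x
    simp only [φ, indicator, sin_dist0]
    rfl
  · rw [inter_comm, ← setLIntegral_indicator hA]
    refine setLIntegral_congr_fun measurableSet_Ioo fun t ht => ?_
    have h1 : 0 < 1 - t ^ 2 := by nlinarith [ht.1, ht.2]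
    by_cases htA : t ∈ A
    · simp only [φ, indicator_of_mem htA]
      rw [← ENNReal.ofReal_mul (by positivity), Real.sqrt_eq_rpow, ← Real.rpow_mul h1.le,
        ← mul_assoc, ← Real.rpow_add h1, mul_comm]
      congr 3
      ring
    · simp [φ, indicator_of_notMem htA]

/-! ### The function `cos d(0,·)` on a totally geodesic submanifold. -/

theorem exists_unit_inner_eq_norm_starProjection_mul {E : Type*} [NormedAddCommGroup E]
    [InnerProductSpace ℝ E] (V : Submodule ℝ E) [V.HasOrthogonalProjection] (v : E)
    (hv : 0 < ‖V.starProjection v‖) :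
    ∃ e : V, ‖e‖ = 1 ∧ ∀ y : V, inner ℝ v (y : E) = ‖V.starProjection v‖ * inner ℝ e y := by
  have hP : ‖V.orthogonalProjectionOnto v‖ = ‖V.starProjection v‖ := rfl
  refine ⟨‖V.starProjection v‖⁻¹ • V.orthogonalProjectionOnto v, ?_, fun y => ?_⟩
  · rw [norm_smul, hP, norm_inv, norm_norm, inv_mul_cancel₀ hv.ne']
  · rw [real_inner_smul_left, mul_inv_cancel_left₀ hv.ne',
      Submodule.inner_orthogonalProjectionOnto_eq_of_mem_right]

namespace GeodesicSubsphere

variable {n k : ℕ}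

/-- The cosine of the distance from the origin to `ξ`. -/
def poleCos (ξ : GeodesicSubsphere n k) : ℝ := ‖ξ.1.starProjection (northPole n)‖

theorem poleCos_le_one (ξ : GeodesicSubsphere n k) : ξ.poleCos ≤ 1 := by
  rw [poleCos, ← norm_northPole n]
  exact ξ.1.norm_starProjection_apply_le _

theorem measurable_poleCos : Measurable (poleCos : GeodesicSubsphere n k → ℝ) := by
  borelize (Ambient n →L[ℝ] Ambient n)
  have h : Measurable fun ξ : GeodesicSubsphere n k => ξ.1.starProjection :=
    comap_measurable _
  have h2 : Continuous fun T : Ambient n →L[ℝ] Ambient n => ‖T (northPole n)‖ := by fun_prop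
  exact h2.measurable.comp h

theorem exists_unit_cos_dist0_incl (ξ : GeodesicSubsphere n k) (hξ : 0 < ξ.poleCos) :
    ∃ e : ξ.1, ‖e‖ = 1 ∧ ∀ y : Metric.sphere (0 : ξ.1) 1,
      Real.cos (SphereKPlane.dist0 (ξ.incl y)) = ξ.poleCos * inner ℝ e (y : ξ.1) := by
  obtain ⟨e, he, hy⟩ := exists_unit_inner_eq_norm_starProjection_mul ξ.1 (northPole n) hξ
  exact ⟨e, he, fun y => (cos_dist0 _).trans (hy y)⟩

/-- The point of `ξ` nearest to the origin is the normalized projection of the pole, so the infimum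
is attained there. -/
theorem cos_dist0_eq_poleCos (ξ : GeodesicSubsphere n k) (hξ : 0 < ξ.poleCos) :
    Real.cos ξ.dist0 = ξ.poleCos := by
  obtain ⟨e, he, hy⟩ := ξ.exists_unit_cos_dist0_incl hξ
  have hl : IsLeast (SphereKPlane.dist0 '' ξ.points) (Real.arccos ξ.poleCos) := by
    constructor
    · refine ⟨ξ.incl ⟨e, by simp [he]⟩, e.2, ?_⟩
      rw [dist0_eq_arccos, ← cos_dist0, hy]
      simp [he]
    · rintro _ ⟨x, hx, rfl⟩
      have hx1 : ‖(⟨x, hx⟩ : ξ.1)‖ = 1 := norm_eq_of_mem_sphere x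
      have := hy ⟨⟨x, hx⟩, by simp [hx1]⟩
      rw [dist0_eq_arccos, ← cos_dist0]
      refine Real.arccos_le_arccos ?_
      have h2 : inner ℝ e (⟨x, hx⟩ : ξ.1) ≤ 1 := by
        simpa [he, hx1] using real_inner_le_norm e (⟨x, hx⟩ : ξ.1)
      calc Real.cos (SphereKPlane.dist0 x) = ξ.poleCos * inner ℝ e (⟨x, hx⟩ : ξ.1) := this
        _ ≤ ξ.poleCos * 1 := by gcongr
        _ = ξ.poleCos := mul_one _
  rw [dist0, hl.csInf_eq, Real.cos_arccos (by linarith) ξ.poleCos_le_one]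

theorem lintegral_measure_cos (hk : 1 ≤ k) (ξ : GeodesicSubsphere n k) (hξ : 0 < ξ.poleCos)
    {φ : ℝ → ℝ≥0∞} (hφ : Measurable φ) :
    ∫⁻ y, φ (Real.cos (SphereKPlane.dist0 (ξ.incl y))) ∂ξ.measure = sphereConst k *
      ∫⁻ u in Ioo (-1 : ℝ) 1, ENNReal.ofReal ((1 - u ^ 2) ^ ((k : ℝ) / 2 - 1)) *
        φ (ξ.poleCos * u) := by
  obtain ⟨e, he, hy⟩ := ξ.exists_unit_cos_dist0_incl hξ
  simp only [hy]
  exact lintegral_toSphere_inner hk ξ.2 he (φ := fun u => φ (ξ.poleCos * u)) (by fun_prop)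

/-- All frame vectors except the one with index `0` are orthogonal to the pole, so the projection of
the pole is `cos h` times that vector. -/
theorem poleCos_param (hk : k < n) (g : SO n) {h : ℝ} (hh : 0 ≤ Real.cos h) :
    (param hk (g, h)).poleCos = Real.cos h := by
  set V := (param hk (g, h)).1 with hV
  have h0 : frame hk g h 0 = Real.cos h • northPole n + Real.sin h • rotVec g ⟨k, hk⟩ := rfl
  have hm : Real.cos h • frame hk g h 0 ∈ V :=
    V.smul_mem _ (Submodule.subset_span (mem_range_self _))
  have ho := orthonormal_iff_ite.1 (frame_orthonormal hk g h)
  have hin : ∀ i, inner ℝ (northPole n) (frame hk g h i) = if i = 0 then Real.cos h else 0 := by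
    intro i
    refine Fin.cases ?_ (fun i => ?_) i
    · simp [h0, inner_add_right, inner_smul_right, inner_northPole_rotVec, norm_northPole]
    · simp [frame, inner_northPole_rotVec]
  have hort : ∀ w ∈ V, inner ℝ (northPole n - Real.cos h • frame hk g h 0) w = 0 := by
    intro w hw
    induction hw using Submodule.span_induction with
    | mem x hx =>
      obtain ⟨i, rfl⟩ := hx
      rw [inner_sub_left, inner_smul_left, hin, ho]
      by_cases hi : i = 0
      · simp [hi]
      · simp [hi, Ne.symm hi]
    | zero => simp
    | add x y _ _ hx hy => rw [inner_add_right, hx, hy, add_zero]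
    | smul c x _ hx => rw [inner_smul_right, hx, mul_zero]
  have hp := Submodule.eq_starProjection_of_mem_of_inner_eq_zero hm hort
  change ‖V.starProjection (northPole n)‖ = Real.cos h
  rw [hp, norm_smul, (frame_orthonormal hk g h).1 0]
  simp [abs_of_nonneg hh]

end GeodesicSubsphere

open GeodesicSubsphere

/-! ### Null sets of the invariant measure. -/

instance (n : ℕ) : IsFiniteMeasure (haarSO n) := by
  unfold haarSO
  infer_instance

instance (n : ℕ) : NeZero (haarSO n) := by
  unfold haarSO
  infer_instance

theorem ae_grassmannMeasure_of_poleCos_pos {n k : ℕ} (hk : k < n)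
    {P : GeodesicSubsphere n k → Prop} (h : ∀ ξ : GeodesicSubsphere n k, 0 < ξ.poleCos → P ξ) :
    ∀ᵐ ξ ∂grassmannMeasure hk, P ξ := by
  have hS : MeasurableSet {ξ : GeodesicSubsphere n k | 0 < ξ.poleCos} :=
    measurableSet_lt measurable_const measurable_poleCos
  suffices h' : ∀ᵐ ξ ∂grassmannMeasure hk, 0 < ξ.poleCos from h'.mono h
  rw [grassmannMeasure, ae_map_iff (measurable_param hk).aemeasurable hS]
  refine (Measure.ae_prod_iff_ae_ae (measurable_param hk hS)).2
    (Filter.Eventually.of_forall fun g => ?_)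
  refine (withDensity_absolutelyContinuous _ _).ae_le ?_
  filter_upwards [ae_restrict_mem measurableSet_Ioo] with t ht
  have hc : 0 < Real.cos t := Real.cos_pos_of_mem_Ioo ⟨by linarith [ht.1, Real.pi_pos], ht.2⟩
  change 0 < (param hk (g, t)).poleCos
  rwa [poleCos_param hk g hc.le]

/-- The density in `h` is positive on `(0, π/2)`, so every interval of cosines is charged. This
converts an essential bound into a bound at a submanifold whose distance to the origin is prescribed
up to an arbitrarily small error. -/
theorem exists_poleCos_mem_Ioo_of_ae {n k : ℕ} (hk : k < n)
    {P : GeodesicSubsphere n k → Prop} (h : ∀ᵐ ξ ∂grassmannMeasure hk, P ξ) {b c : ℝ}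
    (hb : 0 ≤ b) (hbc : b < c) (hc : c ≤ 1) :
    ∃ ξ : GeodesicSubsphere n k, ξ.poleCos ∈ Ioo b c ∧ P ξ := by
  have h1 := ae_of_ae_map (measurable_param hk).aemeasurable h
  obtain ⟨g, hg⟩ := (Measure.ae_ae_of_ae_prod h1).exists
  rw [ae_withDensity_iff (by fun_prop), ae_restrict_iff' measurableSet_Ioo] at hg
  have hlt : Real.arccos c < Real.arccos b :=
    Real.arccos_lt_arccos (by linarith) hbc hc
  have hpos : volume (Ioo (Real.arccos c) (Real.arccos b)) ≠ 0 := by simp [hlt]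
  have hfr : ∃ᵐ t : ℝ, t ∈ Ioo (Real.arccos c) (Real.arccos b) := by
    rwa [frequently_ae_mem_iff]
  obtain ⟨t, ht, hgt⟩ := (hfr.and_eventually hg).exists
  have ht0 : 0 < t := (Real.arccos_nonneg c).trans_lt ht.1
  have ht1 : t < Real.pi / 2 := ht.2.trans_le (Real.arccos_le_pi_div_two.2 hb)
  have hcos : 0 < Real.cos t := Real.cos_pos_of_mem_Ioo ⟨by linarith, ht1⟩
  have hsin : 0 < Real.sin t := Real.sin_pos_of_pos_of_lt_pi ht0 (by linarith)
  refine ⟨param hk (g, t), ?_, hgt ⟨ht0, ht1⟩ ?_⟩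
  · rw [poleCos_param hk g hcos.le]
    have e1 := Real.cos_arccos (x := b) (by linarith) (by linarith)
    have e2 := Real.cos_arccos (x := c) (by linarith) (by linarith)
    have i1 := Real.cos_lt_cos_of_nonneg_of_le_pi ht0.le (Real.arccos_le_pi b) ht.2
    have i2 := Real.cos_lt_cos_of_nonneg_of_le_pi (Real.arccos_nonneg c) (by linarith) ht.1
    exact ⟨by linarith, by linarith⟩
  · have : 0 < Real.sin t ^ (n - k - 1) * Real.cos t ^ k := by positivity
    simpa using this

/-! ### The one-dimensional inequality for `levelMeasure`. -/

/-- Among the sets of given measure, the integral of a power of `g` is smallest, up to a constant,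
on a sublevel set of `g`. -/
theorem measure_rpow_le_of_measure_sublevel_le {X : Type*} [MeasurableSpace X] {ν : Measure X}
    {g : X → ℝ≥0∞} (hg : Measurable g) {K : ℝ≥0∞} (hK0 : K ≠ 0) (hKt : K ≠ ∞)
    (hsub : ∀ r : ℝ≥0∞, r ≠ ∞ → ν {x | g x ≤ r} ≤ K * r) {q : ℝ} (hq : 0 ≤ q) (E : Set X)
    (hE : ν E ≠ ∞) :
    ν E ^ (q + 1) ≤ 2 * (2 * K) ^ q * ∫⁻ x in E, g x ^ q ∂ν := by
  have h2K0 : 2 * K ≠ 0 := by simp [hK0]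
  have h2Kt : 2 * K ≠ ∞ := ENNReal.mul_ne_top (by simp) hKt
  set m := ν E with hm
  -- With this threshold the sublevel set has mass at most `m / 2`, so at least half of the mass of
  -- `E` lies where `g > r`.
  set r := m / (2 * K) with hr
  have hrt : r ≠ ∞ := ENNReal.div_ne_top hE h2K0
  have hKr : K * r = m / 2 := by
    rw [hr, div_eq_mul_inv, ENNReal.mul_inv (by simp) (by simp), div_eq_mul_inv]
    calc K * (m * (2⁻¹ * K⁻¹)) = m * 2⁻¹ * (K * K⁻¹) := by ring
      _ = m * 2⁻¹ := by rw [ENNReal.mul_inv_cancel hK0 hKt, mul_one]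
  have hS : MeasurableSet {x | g x ≤ r} := measurableSet_le hg measurable_const
  have h1 : m / 2 ≤ ν (E \ {x | g x ≤ r}) := by
    have h2 : m ≤ ν (E ∩ {x | g x ≤ r}) + ν (E \ {x | g x ≤ r}) :=
      (measure_inter_add_sdiff E hS).ge
    have h3 : ν (E ∩ {x | g x ≤ r}) ≤ m / 2 :=
      (measure_mono inter_subset_right).trans ((hsub r hrt).trans_eq hKr)
    have h4 : m / 2 + m / 2 ≤ m / 2 + ν (E \ {x | g x ≤ r}) := by
      rw [ENNReal.add_halves]
      exact h2.trans (by gcongr)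
    exact (ENNReal.add_le_add_iff_left (ENNReal.div_ne_top hE (by simp))).1 h4
  have h5 : r ^ q * (m / 2) ≤ ∫⁻ x in E, g x ^ q ∂ν := by
    calc r ^ q * (m / 2) ≤ r ^ q * ν (E \ {x | g x ≤ r}) := by gcongr
      _ = r ^ q * (ν.restrict E) {x | g x ≤ r}ᶜ := by
        rw [Measure.restrict_apply hS.compl, inter_comm, sdiff_eq]
      _ = ∫⁻ _ in {x | g x ≤ r}ᶜ, r ^ q ∂(ν.restrict E) := by rw [setLIntegral_const]
      _ ≤ ∫⁻ x in {x | g x ≤ r}ᶜ, g x ^ q ∂(ν.restrict E) := by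
        refine setLIntegral_mono' hS.compl fun x hx => ?_
        exact ENNReal.rpow_le_rpow (not_le.1 (mem_compl_iff _ _ |>.1 hx)).le hq
      _ ≤ ∫⁻ x in E, g x ^ q ∂ν := setLIntegral_le_lintegral _ _
  calc m ^ (q + 1) = 2 * (2 * K) ^ q * (r ^ q * (m / 2)) := by
        rw [ENNReal.rpow_add_of_nonneg _ _ hq zero_le_one, ENNReal.rpow_one]
        have e1 : (2 * K) ^ q * r ^ q = m ^ q := by
          rw [← ENNReal.mul_rpow_of_nonneg _ _ hq, hr, ENNReal.mul_div_cancel h2K0 h2Kt]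
        have e2 : 2 * (m / 2) = m := ENNReal.mul_div_cancel (by simp) (by simp)
        calc m ^ q * m = ((2 * K) ^ q * r ^ q) * (2 * (m / 2)) := by rw [e1, e2]
          _ = _ := by ring
    _ ≤ _ := by gcongr

/-- The measure `(1 - u²)^(k/2 - 1) du` on `(-1, 1)`. -/
def levelMeasure (k : ℕ) : Measure ℝ :=
  (volume.restrict (Ioo (-1 : ℝ) 1)).withDensity fun u =>
    ENNReal.ofReal ((1 - u ^ 2) ^ ((k : ℝ) / 2 - 1))

theorem levelMeasure_apply (k : ℕ) {A : Set ℝ} (hA : MeasurableSet A) :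
    levelMeasure k A =
      ∫⁻ u in Ioo (-1 : ℝ) 1 ∩ A, ENNReal.ofReal ((1 - u ^ 2) ^ ((k : ℝ) / 2 - 1)) := by
  rw [levelMeasure, withDensity_apply _ hA, Measure.restrict_restrict hA, inter_comm]

theorem one_sub_sq_pos_of_mem_Ioo {u : ℝ} (hu : u ∈ Ioo (-1 : ℝ) 1) : 0 < 1 - u ^ 2 := by
  nlinarith [hu.1, hu.2]

/-- For `|u| > 1/2` the density is at most twice the absolute derivative `k|u|(1-u²)^(k/2-1)` of `G
= (1-u²)^(k/2)`. Taking `G` as variable bounds the mass by twice the length of the image, which lies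
in `[0, 2r]`. The sign `σ` selects the endpoint. -/
theorem lintegral_near_endpoint_le {k : ℕ} (hk : 1 ≤ k) {σ : ℝ} (hσ : σ = 1 ∨ σ = -1)
    (r : ℝ) :
    ∫⁻ u in {u : ℝ | 1 / 2 < σ * u ∧ σ * u < 1 ∧ |u| * (1 - u ^ 2) ^ ((k : ℝ) / 2) ≤ r},
      ENNReal.ofReal ((1 - u ^ 2) ^ ((k : ℝ) / 2 - 1)) ≤ ENNReal.ofReal (4 * r) := by
  have hk1 : (1 : ℝ) ≤ k := by exact_mod_cast hk
  have hσ2 : σ ^ 2 = 1 := by rcases hσ with rfl | rfl <;> norm_num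
  have hu2 : ∀ u : ℝ, u ^ 2 = (σ * u) ^ 2 := fun u => by rw [mul_pow, hσ2, one_mul]
  have habs : ∀ u : ℝ, 0 < σ * u → |u| = σ * u := by
    intro u h
    have : |σ * u| = |u| := by rcases hσ with rfl | rfl <;> simp
    rw [← this, abs_of_pos h]
  set B := {u : ℝ | 1 / 2 < σ * u ∧ σ * u < 1 ∧ |u| * (1 - u ^ 2) ^ ((k : ℝ) / 2) ≤ r} with hB
  have hBm : MeasurableSet B := by
    have h1 : MeasurableSet {u : ℝ | 1 / 2 < σ * u} := measurableSet_lt (by fun_prop) (by fun_prop)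
    have h2 : MeasurableSet {u : ℝ | σ * u < 1} := measurableSet_lt (by fun_prop) (by fun_prop)
    have h3 : MeasurableSet {u : ℝ | |u| * (1 - u ^ 2) ^ ((k : ℝ) / 2) ≤ r} :=
      measurableSet_le (by fun_prop) (by fun_prop)
    exact h1.inter (h2.inter h3)
  have hpos : ∀ u ∈ B, 0 < 1 - u ^ 2 := by
    intro u hu
    rw [hu2]
    nlinarith [hu.1, hu.2.1]
  let G : ℝ → ℝ := fun u => (1 - u ^ 2) ^ ((k : ℝ) / 2)
  let G' : ℝ → ℝ := fun u => -(2 * u) * ((k : ℝ) / 2) * (1 - u ^ 2) ^ ((k : ℝ) / 2 - 1)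
  have hder : ∀ u ∈ B, HasDerivWithinAt G (G' u) B u := by
    intro u hu
    have h1 : HasDerivAt (fun u : ℝ => 1 - u ^ 2) (-(2 * u)) u := by
      simpa using (hasDerivAt_pow 2 u).const_sub 1
    exact (h1.rpow_const (Or.inl (hpos u hu).ne')).hasDerivWithinAt
  have hinj : InjOn G B := by
    intro u hu v hv huv
    have h1 : 1 - u ^ 2 = 1 - v ^ 2 :=
      Real.rpow_left_injOn (by positivity) (hpos u hu).le (hpos v hv).le huv
    rw [hu2 u, hu2 v] at h1
    have h2 : σ * u = σ * v := by nlinarith [hu.1, hv.1]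
    exact mul_left_cancel₀ (by rcases hσ with rfl | rfl <;> norm_num) h2
  have hle : ∀ u ∈ B, ENNReal.ofReal ((1 - u ^ 2) ^ ((k : ℝ) / 2 - 1)) ≤
      2 * (ENNReal.ofReal |G' u| * 1) := by
    intro u hu
    have h1 := Real.rpow_pos_of_pos (hpos u hu) ((k : ℝ) / 2 - 1)
    have h2 : |G' u| = σ * u * k * (1 - u ^ 2) ^ ((k : ℝ) / 2 - 1) := by
      have h3 : |G' u| = |u| * k * (1 - u ^ 2) ^ ((k : ℝ) / 2 - 1) := by
        simp only [G']
        rw [abs_mul, abs_mul, abs_of_pos h1, abs_neg, abs_mul]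
        simp only [Nat.abs_ofNat, abs_div, Nat.abs_cast]
        ring
      rw [h3, habs u (by linarith [hu.1])]
    rw [mul_one, ← ENNReal.ofReal_ofNat, ← ENNReal.ofReal_mul (by norm_num), h2]
    refine ENNReal.ofReal_le_ofReal ?_
    have h4 : 1 ≤ 2 * (σ * u * k) := by nlinarith [hu.1]
    nlinarith
  calc _ ≤ ∫⁻ u in B, 2 * (ENNReal.ofReal |G' u| * 1) := setLIntegral_mono' hBm hle
    _ = 2 * volume (G '' B) := by
      rw [lintegral_const_mul _ (by fun_prop),
        ← lintegral_image_eq_lintegral_abs_deriv_mul hBm hder hinj (fun _ => 1)]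
      simp
    _ ≤ 2 * volume (Icc 0 (2 * r)) := by
      gcongr
      rintro _ ⟨u, hu, rfl⟩
      have h1 := Real.rpow_pos_of_pos (hpos u hu) ((k : ℝ) / 2)
      have h2 := hu.2.2
      rw [habs u (by linarith [hu.1])] at h2
      refine ⟨h1.le, ?_⟩
      change (1 - u ^ 2) ^ ((k : ℝ) / 2) ≤ 2 * r
      nlinarith [hu.1]
    _ = ENNReal.ofReal (4 * r) := by
      rw [Real.volume_Icc, ← ENNReal.ofReal_ofNat, ← ENNReal.ofReal_mul (by norm_num)]
      congr 1
      ring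

theorem levelMeasure_sublevel_le {k : ℕ} (hk : 1 ≤ k) :
    ∃ K : ℝ≥0∞, K ≠ 0 ∧ K ≠ ∞ ∧ ∀ r : ℝ≥0∞, r ≠ ∞ →
      levelMeasure k {u | ENNReal.ofReal (|u| * (1 - u ^ 2) ^ ((k : ℝ) / 2)) ≤ r} ≤ K * r := by
  have hk1 : (1 : ℝ) ≤ k := by exact_mod_cast hk
  -- For `|u| ≤ 1/2` one has `1-u² ≥ 3/4`, so the sublevel condition gives `|u| ≤ D r` and the
  -- density is at most `4/3`. The constant below adds this middle part to `4` for each endpoint.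
  set D : ℝ := (4 / 3) ^ ((k : ℝ) / 2) with hD
  have hD0 : 0 < D := by positivity
  refine ⟨ENNReal.ofReal (4 / 3 * (2 * D) + 4 + 4), ?_, ENNReal.ofReal_ne_top, fun r hr => ?_⟩
  · rw [Ne, ENNReal.ofReal_eq_zero, not_le]
    positivity
  lift r to ℝ≥0 using hr
  have hr : 0 ≤ (r : ℝ) := r.2
  have hset : {u : ℝ | ENNReal.ofReal (|u| * (1 - u ^ 2) ^ ((k : ℝ) / 2)) ≤ r} =
      {u : ℝ | |u| * (1 - u ^ 2) ^ ((k : ℝ) / 2) ≤ r} := by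
    ext u
    exact ENNReal.ofReal_le_coe
  have hm : MeasurableSet {u : ℝ | |u| * (1 - u ^ 2) ^ ((k : ℝ) / 2) ≤ r} :=
    measurableSet_le (by fun_prop) (by fun_prop)
  rw [hset, levelMeasure_apply k hm]
  let Bp : ℝ → Set ℝ := fun σ =>
    {u : ℝ | 1 / 2 < σ * u ∧ σ * u < 1 ∧ |u| * (1 - u ^ 2) ^ ((k : ℝ) / 2) ≤ r}
  let A : Set ℝ := Icc (-(1 / 2)) (1 / 2) ∩ Icc (-(D * r)) (D * r)
  have hsub : Ioo (-1 : ℝ) 1 ∩ {u : ℝ | |u| * (1 - u ^ 2) ^ ((k : ℝ) / 2) ≤ r} ⊆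
      A ∪ Bp 1 ∪ Bp (-1) := by
    rintro u ⟨hu, hur⟩
    rcases lt_or_ge (1 / 2) u with h | h
    · exact Or.inl (Or.inr ⟨by simpa using h, by simpa using hu.2, hur⟩)
    rcases lt_or_ge u (-(1 / 2)) with h' | h'
    · exact Or.inr ⟨by linarith, by linarith [hu.1], hur⟩
    refine Or.inl (Or.inl ⟨⟨h', h⟩, abs_le.1 ?_⟩)
    have h1 : 3 / 4 ≤ 1 - u ^ 2 := by nlinarith
    have h2 : D * (1 - u ^ 2) ^ ((k : ℝ) / 2) ≥ 1 := by
      rw [hD, ← Real.mul_rpow (by norm_num) (by linarith)]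
      exact Real.one_le_rpow (by linarith) (by positivity)
    have h3 : |u| * (1 - u ^ 2) ^ ((k : ℝ) / 2) ≤ r := hur
    calc |u| ≤ |u| * (D * (1 - u ^ 2) ^ ((k : ℝ) / 2)) := le_mul_of_one_le_right (abs_nonneg _) h2
      _ = D * (|u| * (1 - u ^ 2) ^ ((k : ℝ) / 2)) := by ring
      _ ≤ D * r := by gcongr
  have hA : ∫⁻ u in A, ENNReal.ofReal ((1 - u ^ 2) ^ ((k : ℝ) / 2 - 1)) ≤
      ENNReal.ofReal (4 / 3 * (2 * D * r)) := by
    calc _ ≤ ∫⁻ _ in A, ENNReal.ofReal (4 / 3) := by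
          refine setLIntegral_mono' (measurableSet_Icc.inter measurableSet_Icc) fun u hu => ?_
          refine ENNReal.ofReal_le_ofReal ?_
          have h1 : 3 / 4 ≤ 1 - u ^ 2 := by nlinarith [hu.1.1, hu.1.2]
          have h2 : 1 - u ^ 2 ≤ 1 := by nlinarith [sq_nonneg u]
          calc (1 - u ^ 2) ^ ((k : ℝ) / 2 - 1) ≤ (1 - u ^ 2) ^ (-1 : ℝ) :=
                Real.rpow_le_rpow_of_exponent_ge (by linarith) h2 (by linarith)
            _ = (1 - u ^ 2)⁻¹ := Real.rpow_neg_one _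
            _ ≤ (3 / 4)⁻¹ := by gcongr
            _ = 4 / 3 := by norm_num
      _ = ENNReal.ofReal (4 / 3) * volume A := by rw [setLIntegral_const]
      _ ≤ ENNReal.ofReal (4 / 3) * volume (Icc (-(D * r)) (D * r)) := by
          gcongr
          exact inter_subset_right
      _ = _ := by
          rw [Real.volume_Icc, ← ENNReal.ofReal_mul (by norm_num)]
          congr 1
          ring
  calc _ ≤ ∫⁻ u in A ∪ Bp 1 ∪ Bp (-1), ENNReal.ofReal ((1 - u ^ 2) ^ ((k : ℝ) / 2 - 1)) :=
        lintegral_mono_set hsub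
    _ ≤ (∫⁻ u in A, ENNReal.ofReal ((1 - u ^ 2) ^ ((k : ℝ) / 2 - 1))) +
        (∫⁻ u in Bp 1, ENNReal.ofReal ((1 - u ^ 2) ^ ((k : ℝ) / 2 - 1))) +
        ∫⁻ u in Bp (-1), ENNReal.ofReal ((1 - u ^ 2) ^ ((k : ℝ) / 2 - 1)) :=
        (lintegral_union_le _ _ _).trans (by gcongr; exact lintegral_union_le _ _ _)
    _ ≤ ENNReal.ofReal (4 / 3 * (2 * D * r)) + ENNReal.ofReal (4 * r) +
        ENNReal.ofReal (4 * r) := by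
        gcongr
        · exact lintegral_near_endpoint_le hk (Or.inl rfl) r
        · exact lintegral_near_endpoint_le hk (Or.inr rfl) r
    _ = _ := by
        rw [← ENNReal.ofReal_add (by positivity) (by positivity),
          ← ENNReal.ofReal_add (by positivity) (by positivity), ← ENNReal.ofReal_coe_nnreal,
          ← ENNReal.ofReal_mul (by positivity)]
        congr 1
        ring

theorem lintegral_levelMeasure (k : ℕ) {φ : ℝ → ℝ≥0∞} (hφ : Measurable φ) :
    ∫⁻ u, φ u ∂levelMeasure k =
      ∫⁻ u in Ioo (-1 : ℝ) 1, ENNReal.ofReal ((1 - u ^ 2) ^ ((k : ℝ) / 2 - 1)) * φ u := by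
  rw [levelMeasure, lintegral_withDensity_eq_lintegral_mul _ (by fun_prop) hφ]
  rfl

/-- On `(-1,1)` the function in the sublevel estimate is at most `1`, so the sublevel set at `r = 1`
carries all the mass. -/
theorem levelMeasure_univ_ne_top {k : ℕ} (hk : 1 ≤ k) : levelMeasure k univ ≠ ∞ := by
  obtain ⟨K, -, hKt, hK⟩ := levelMeasure_sublevel_le hk
  have h1 := hK 1 (by simp)
  have hm : MeasurableSet {u : ℝ | ENNReal.ofReal (|u| * (1 - u ^ 2) ^ ((k : ℝ) / 2)) ≤ 1} :=
    measurableSet_le (by fun_prop) (by fun_prop)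
  rw [levelMeasure_apply k hm, inter_eq_left.2, mul_one] at h1
  · rw [levelMeasure_apply k .univ, inter_univ]
    exact ne_top_of_le_ne_top hKt h1
  · intro u hu
    have h2 := one_sub_sq_pos_of_mem_Ioo hu
    refine ENNReal.ofReal_le_one.2 (mul_le_one₀ (abs_le.2 ⟨hu.1.le, hu.2.le⟩) (by positivity) ?_)
    exact Real.rpow_le_one h2.le (by nlinarith [sq_nonneg u]) (by positivity)

theorem lintegral_comp_mul_left_real {a : ℝ} (ha : 0 < a) {φ : ℝ → ℝ≥0∞} (hφ : Measurable φ) :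
    ∫⁻ u, φ (a * u) = ENNReal.ofReal a⁻¹ * ∫⁻ t, φ t := by
  rw [← lintegral_map hφ (measurable_const_mul a), Real.map_volume_mul_left ha.ne',
    lintegral_smul_measure, abs_of_pos (inv_pos.2 ha), smul_eq_mul]

/-- The weighted isoperimetric-type inequality behind the endpoint estimate. -/
theorem levelMeasure_rpow_le {k : ℕ} (hk : 1 ≤ k) {p α₂ : ℝ} (hp : 1 ≤ p) (hpα : 1 + α₂ ≤ p) :
    ∃ K : ℝ≥0∞, K ≠ ∞ ∧ ∀ E : Set ℝ, MeasurableSet E → levelMeasure k E ^ p ≤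
      K * ∫⁻ u in Ioo (-1 : ℝ) 1 ∩ E,
        ENNReal.ofReal (|u| ^ α₂ * (1 - u ^ 2) ^ (k * p / 2 - 1)) := by
  obtain ⟨K, hK0, hKt, hK⟩ := levelMeasure_sublevel_le hk
  have hq : 0 ≤ p - 1 := by linarith
  refine ⟨2 * (2 * K) ^ (p - 1), ENNReal.mul_ne_top (by simp) (ENNReal.rpow_ne_top_of_nonneg hq
    (ENNReal.mul_ne_top (by simp) hKt)), fun E hE => ?_⟩
  have h1 := measure_rpow_le_of_measure_sublevel_le (ν := levelMeasure k) (by fun_prop) hK0 hKt hK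
    hq E (ne_top_of_le_ne_top (levelMeasure_univ_ne_top hk) (measure_mono (subset_univ _)))
  rw [sub_add_cancel] at h1
  refine h1.trans (mul_le_mul' le_rfl ?_)
  rw [← lintegral_indicator hE, lintegral_levelMeasure k (Measurable.indicator (by fun_prop) hE),
    inter_comm, ← setLIntegral_indicator hE]
  refine lintegral_mono_ae ?_
  -- The convention `0 ^ α₂ = 0` for negative `α₂` can break `|u|^(p-1) ≤ |u|^α₂` at the origin.
  have hne : ∀ᵐ u ∂volume.restrict (Ioo (-1 : ℝ) 1), u ≠ 0 :=
    ae_restrict_of_ae (Measure.ae_ne volume 0)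
  filter_upwards [ae_restrict_mem measurableSet_Ioo, hne] with u hu hu0
  by_cases huE : u ∈ E
  · rw [indicator_of_mem huE, indicator_of_mem huE]
    have h2 := one_sub_sq_pos_of_mem_Ioo hu
    have h3 : 0 < |u| := abs_pos.2 hu0
    have h4 : |u| ≤ 1 := abs_le.2 ⟨hu.1.le, hu.2.le⟩
    rw [ENNReal.ofReal_rpow_of_nonneg (by positivity) hq, ← ENNReal.ofReal_mul (by positivity)]
    refine ENNReal.ofReal_le_ofReal ?_
    calc _ = |u| ^ (p - 1) * (1 - u ^ 2) ^ (k * p / 2 - 1) := by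
          rw [Real.mul_rpow h3.le (by positivity), ← Real.rpow_mul h2.le, mul_left_comm,
            ← Real.rpow_add h2]
          congr 2
          ring
      _ ≤ _ := by
          gcongr 1
          exact Real.rpow_le_rpow_of_exponent_ge h3 h4 (by linarith)
  · simp [indicator_of_notMem huE]

/-- Under `t = au` the weight `|u|^α₂ du` becomes `a^(-(1+α₂)) |t|^α₂ dt`. Since `a ≤ 1`, replacing
`1-u²` by the larger `1-(au)²` increases the integrand when the exponent `kp/2 - 1` is nonnegative;
`hkp` enters only there. -/
theorem levelMeasure_preimage_mul_rpow_le {k : ℕ} (hk : 1 ≤ k) {p α₂ : ℝ} (hp : 1 ≤ p)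
    (hpα : 1 + α₂ ≤ p) (hkp : 2 ≤ k * p) :
    ∃ K : ℝ≥0∞, K ≠ ∞ ∧ ∀ a : ℝ, 0 < a → a ≤ 1 → ∀ A : Set ℝ, MeasurableSet A →
      levelMeasure k {u | a * u ∈ A} ^ p ≤ K * (ENNReal.ofReal (a ^ (-(1 + α₂))) *
        ∫⁻ t in Ioo (-1 : ℝ) 1 ∩ A,
          ENNReal.ofReal (|t| ^ α₂ * (1 - t ^ 2) ^ (k * p / 2 - 1))) := by
  obtain ⟨K, hKt, hK⟩ := levelMeasure_rpow_le hk hp hpα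
  refine ⟨K, hKt, fun a ha ha1 A hA => ?_⟩
  have hE : MeasurableSet {u | a * u ∈ A} := measurable_const_mul a hA
  refine (hK _ hE).trans ?_
  gcongr
  let φ : ℝ → ℝ≥0∞ := (Ioo (-1 : ℝ) 1 ∩ A).indicator fun t =>
    ENNReal.ofReal (|t| ^ α₂ * (1 - t ^ 2) ^ (k * p / 2 - 1))
  have hφ : Measurable φ := Measurable.indicator (by fun_prop) (measurableSet_Ioo.inter hA)
  calc _ ≤ ∫⁻ u, ENNReal.ofReal (a ^ (-α₂)) * φ (a * u) := by
        rw [← lintegral_indicator (measurableSet_Ioo.inter hE)]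
        refine lintegral_mono fun u => ?_
        by_cases hu : u ∈ Ioo (-1 : ℝ) 1 ∩ {u | a * u ∈ A}
        · have h1 := one_sub_sq_pos_of_mem_Ioo hu.1
          have h2 : a * u ∈ Ioo (-1 : ℝ) 1 := by
            constructor <;> nlinarith [hu.1.1, hu.1.2]
          have h3 : 1 - u ^ 2 ≤ 1 - (a * u) ^ 2 := by
            have : a ^ 2 ≤ 1 := pow_le_one₀ ha.le ha1
            nlinarith [sq_nonneg u]
          rw [indicator_of_mem hu]
          simp only [φ, indicator_of_mem (show a * u ∈ Ioo (-1 : ℝ) 1 ∩ A from ⟨h2, hu.2⟩)]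
          rw [← ENNReal.ofReal_mul (by positivity)]
          refine ENNReal.ofReal_le_ofReal ?_
          have h4 : |u| ^ α₂ = a ^ (-α₂) * |a * u| ^ α₂ := by
            rw [abs_mul, abs_of_pos ha, Real.mul_rpow ha.le (abs_nonneg u), ← mul_assoc,
              ← Real.rpow_add ha, neg_add_cancel, Real.rpow_zero, one_mul]
          rw [h4, mul_assoc]
          have : 0 ≤ k * p / 2 - 1 := by linarith
          gcongr
        · rw [indicator_of_notMem hu]
          exact zero_le
    _ = ENNReal.ofReal (a ^ (-α₂)) * (ENNReal.ofReal a⁻¹ * ∫⁻ t, φ t) := by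
        rw [lintegral_const_mul _ (by fun_prop), lintegral_comp_mul_left_real ha hφ]
    _ = _ := by
        rw [← mul_assoc, ← ENNReal.ofReal_mul (by positivity),
          lintegral_indicator (measurableSet_Ioo.inter hA), ← Real.rpow_neg_one,
          ← Real.rpow_add ha]
        congr 3
        ring

/-! ### Sufficiency of the conditions. -/

theorem lorentzNorm_one {X : Type*} [MeasurableSpace X] (f : X → ℂ) (p : ℝ) (μ : Measure X) :
    lorentzNorm f p 1 μ =
      ENNReal.ofReal p * ∫⁻ s in Ioi (0 : ℝ), distribution f μ s ^ (1 / p) := by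
  simp only [lorentzNorm, div_one, ENNReal.rpow_one]
  congr 1
  refine setLIntegral_congr_fun measurableSet_Ioi fun s hs => ?_
  exact ENNReal.mul_div_cancel_right (by simpa using hs) ENNReal.ofReal_ne_top

/-- The profile of a radial function need not be measurable as given; restricting `f` to a
measurable meridian supplies one that is. -/
theorem exists_measurable_profile {n : ℕ} (hn : 1 ≤ n) {f : Sph n → ℂ}
    (hf : f ∈ radialFunctions n) (hfm : Measurable f) :
    ∃ F : ℝ → ℂ, Measurable F ∧ ∀ x, f x = F (Real.cos (dist0 x)) := by
  obtain ⟨F, hF⟩ := hf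
  obtain ⟨s, hs, hsc⟩ := exists_measurable_section hn
  refine ⟨fun t => f (s t), hfm.comp hs, fun x => ?_⟩
  dsimp only
  rw [hF, hF, hsc _ (cos_dist0_mem_Icc x)]

/-- The endpoint estimate for the transform of `|f|`, pointwise in `ξ`. -/
theorem lintegral_enorm_incl_le {n k : ℕ} (hk : 1 ≤ k) (hkn : k < n) {α₁ α₂ p : ℝ} (hp : 1 ≤ p)
    (hpα : 1 + α₂ ≤ p) (hα : α₁ + n = k * p) (hkp : 2 ≤ k * p) :
    ∃ K : ℝ≥0∞, K ≠ ∞ ∧ ∀ f ∈ radialFunctions n, Measurable f →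
      ∀ ξ : GeodesicSubsphere n k, 0 < ξ.poleCos →
        ∫⁻ y, ‖f (ξ.incl y)‖ₑ ∂ξ.measure ≤ K * (ENNReal.ofReal (ξ.poleCos ^ (-((1 + α₂) / p))) *
          lorentzNorm f p 1 (weightedMeasure n α₁ α₂)) := by
  have hn : 1 ≤ n := by omega
  have hp0 : 0 < p := by linarith
  have hp' : 0 ≤ 1 / p := by positivity
  have hop : ENNReal.ofReal p ≠ 0 := by simpa using hp0
  obtain ⟨K, hKt, hK⟩ := levelMeasure_preimage_mul_rpow_le hk hp hpα hkp
  set c := sphereConst n with hc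
  have hc0 : c ≠ 0 := sphereConst_ne_zero hn
  refine ⟨sphereConst k * ((K * c⁻¹) ^ (1 / p) * (ENNReal.ofReal p)⁻¹),
    ENNReal.mul_ne_top (sphereConst_ne_top k) (ENNReal.mul_ne_top
      (ENNReal.rpow_ne_top_of_nonneg hp' (ENNReal.mul_ne_top hKt (ENNReal.inv_ne_top.2 hc0)))
      (ENNReal.inv_ne_top.2 hop)), fun f hf hfm ξ hξ => ?_⟩
  obtain ⟨F, hFm, hF⟩ := exists_measurable_profile hn hf hfm
  set a := ξ.poleCos with ha
  have hlev : ∀ s : ℝ, levelMeasure k {u | s < ‖F (a * u)‖} ≤ (K * c⁻¹) ^ (1 / p) *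
      ENNReal.ofReal (a ^ (-((1 + α₂) / p))) *
        distribution f (weightedMeasure n α₁ α₂) s ^ (1 / p) := by
    intro s
    have hA : MeasurableSet {t | s < ‖F t‖} := measurableSet_lt measurable_const hFm.norm
    have h1 := hK a hξ ξ.poleCos_le_one _ hA
    have h2 : distribution f (weightedMeasure n α₁ α₂) s =
        c * ∫⁻ t in Ioo (-1 : ℝ) 1 ∩ {t | s < ‖F t‖},
          ENNReal.ofReal (|t| ^ α₂ * (1 - t ^ 2) ^ (k * p / 2 - 1)) := by
      rw [← hα, ← weightedMeasure_cos_mem hn α₁ α₂ hA]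
      simp only [distribution, hF]
      rfl
    have h3 : ∫⁻ t in Ioo (-1 : ℝ) 1 ∩ {t | s < ‖F t‖},
        ENNReal.ofReal (|t| ^ α₂ * (1 - t ^ 2) ^ (k * p / 2 - 1)) =
          c⁻¹ * distribution f (weightedMeasure n α₁ α₂) s := by
      rw [h2, ← mul_assoc, ENNReal.inv_mul_cancel hc0 (sphereConst_ne_top n), one_mul]
    rw [h3] at h1
    have h4 := ENNReal.rpow_le_rpow h1 hp'
    rw [← ENNReal.rpow_mul, mul_one_div_cancel hp0.ne', ENNReal.rpow_one] at h4
    refine h4.trans_eq ?_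
    have h5 : ENNReal.ofReal (a ^ (-((1 + α₂) / p))) =
        ENNReal.ofReal (a ^ (-(1 + α₂))) ^ (1 / p) := by
      rw [ENNReal.ofReal_rpow_of_nonneg (by positivity) hp', ← Real.rpow_mul hξ.le]
      congr 2
      ring
    rw [h5, ← ENNReal.mul_rpow_of_nonneg _ _ hp', ← ENNReal.mul_rpow_of_nonneg _ _ hp']
    congr 1
    ring
  calc ∫⁻ y, ‖f (ξ.incl y)‖ₑ ∂ξ.measure
      = ∫⁻ y, ‖F (Real.cos (dist0 (ξ.incl y)))‖ₑ ∂ξ.measure := by simp only [hF]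
    _ = sphereConst k * ∫⁻ u, ‖F (a * u)‖ₑ ∂levelMeasure k := by
      rw [ξ.lintegral_measure_cos hk hξ (φ := fun t => ‖F t‖ₑ) (by fun_prop),
        lintegral_levelMeasure k (by fun_prop)]
    -- After the layer-cake formula, the set inequality at each level leaves the integral of the
    -- distribution function to the power `1/p`, which is the norm with second index `1`.
    _ = sphereConst k * ∫⁻ s in Ioi (0 : ℝ), levelMeasure k {u | s < ‖F (a * u)‖} := by
      rw [← lintegral_eq_lintegral_meas_lt _ (Filter.Eventually.of_forall fun u => norm_nonneg _)
        (by fun_prop)]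
      simp only [ofReal_norm]
    _ ≤ sphereConst k * ∫⁻ s in Ioi (0 : ℝ), (K * c⁻¹) ^ (1 / p) *
          ENNReal.ofReal (a ^ (-((1 + α₂) / p))) *
            distribution f (weightedMeasure n α₁ α₂) s ^ (1 / p) := by
      gcongr with s
      exact hlev s
    _ = _ := by
      rw [lorentzNorm_one, lintegral_const_mul]
      · rw [show ∀ x y z w v i : ℝ≥0∞, x * (y * i) * (z * (w * v)) = x * (y * z * v) * (i * w) by
          intros; ring, ENNReal.inv_mul_cancel hop ENNReal.ofReal_ne_top, mul_one]
      · have : Antitone (distribution f (weightedMeasure n α₁ α₂)) := fun s t hst =>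
          measure_mono fun x hx => lt_of_le_of_lt hst hx
        exact this.measurable.pow_const _

theorem endpointEstimate_of_le {n k : ℕ} (hk : 1 ≤ k) (hkn : k < n) {𝒞 : Set (Sph n → ℂ)}
    (h𝒞 : 𝒞 ⊆ radialFunctions n) {α₁ α₂ p γ : ℝ} (hp : 1 ≤ p)
    (hpα : 1 + α₂ ≤ p) (hα : α₁ + n = k * p) (hkp : 2 ≤ k * p) (hγ : (1 + α₂) / p ≤ γ) :
    EndpointEstimate hkn 𝒞 α₁ α₂ p γ := by
  obtain ⟨K, hKt, hK⟩ := lintegral_enorm_incl_le hk hkn hp hpα hα hkp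
  lift K to ℝ≥0 using hKt
  refine ⟨K, fun f hf hfL => ⟨?_, ?_⟩⟩
  · refine ae_grassmannMeasure_of_poleCos_pos hkn fun ξ hξ => ?_
    have hi : Measurable ξ.incl := by
      unfold GeodesicSubsphere.incl
      exact Measurable.subtype_mk (by fun_prop)
    refine ⟨(hfL.1.comp hi).aestronglyMeasurable, ?_⟩
    refine (hK f (h𝒞 hf) hfL.1 ξ hξ).trans_lt ?_
    exact ENNReal.mul_lt_top ENNReal.coe_lt_top
      (ENNReal.mul_lt_top ENNReal.ofReal_lt_top hfL.2)
  · rw [eLpNorm_exponent_top]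
    refine eLpNormEssSup_le_of_ae_enorm_bound ?_
    refine ae_grassmannMeasure_of_poleCos_pos hkn fun ξ hξ => ?_
    rw [ξ.cos_dist0_eq_poleCos hξ, enorm_mul]
    have h1 : ‖((ξ.poleCos ^ γ : ℝ) : ℂ)‖ₑ = ENNReal.ofReal (ξ.poleCos ^ γ) := by
      rw [← ofReal_norm, Complex.norm_real, Real.norm_of_nonneg (by positivity)]
    have h2 : ‖kPlane f ξ‖ₑ ≤ ∫⁻ y, ‖f (ξ.incl y)‖ₑ ∂ξ.measure :=
      enorm_integral_le_lintegral_enorm _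
    have h3 : ENNReal.ofReal (ξ.poleCos ^ γ) *
        ENNReal.ofReal (ξ.poleCos ^ (-((1 + α₂) / p))) ≤ 1 := by
      rw [← ENNReal.ofReal_mul (by positivity), ← Real.rpow_add hξ]
      exact ENNReal.ofReal_le_one.2 (Real.rpow_le_one hξ.le ξ.poleCos_le_one (by linarith))
    rw [h1]
    calc _ ≤ ENNReal.ofReal (ξ.poleCos ^ γ) *
          (K * (ENNReal.ofReal (ξ.poleCos ^ (-((1 + α₂) / p))) *
            lorentzNorm f p 1 (weightedMeasure n α₁ α₂))) := by
          gcongr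
          exact h2.trans (hK f (h𝒞 hf) hfL.1 ξ hξ)
      _ = (ENNReal.ofReal (ξ.poleCos ^ γ) * ENNReal.ofReal (ξ.poleCos ^ (-((1 + α₂) / p)))) *
          (K * lorentzNorm f p 1 (weightedMeasure n α₁ α₂)) := by ring
      _ ≤ 1 * (K * lorentzNorm f p 1 (weightedMeasure n α₁ α₂)) := by gcongr
      _ = _ := one_mul _

/-! ### Necessity: testing on indicators. -/

theorem lorentzNorm_indicator_one_le {X : Type*} [MeasurableSpace X] (μ : Measure X) (S : Set X)
    {p : ℝ} (hp : 0 < p) :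
    lorentzNorm (S.indicator fun _ => (1 : ℂ)) p 1 μ ≤ ENNReal.ofReal p * μ S ^ (1 / p) := by
  rw [lorentzNorm_one]
  gcongr
  have hp' : 0 < 1 / p := by positivity
  calc ∫⁻ s in Ioi (0 : ℝ), distribution (S.indicator fun _ => (1 : ℂ)) μ s ^ (1 / p)
      ≤ ∫⁻ s in Ioi (0 : ℝ), (Iio 1).indicator (fun _ => μ S ^ (1 / p)) s := by
        refine setLIntegral_mono' measurableSet_Ioi fun s hs => ?_
        by_cases h1 : s < 1
        · rw [indicator_of_mem (mem_Iio.2 h1)]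
          refine ENNReal.rpow_le_rpow (measure_mono fun x hx => ?_) hp'.le
          by_contra hxS
          have h2 : s < ‖S.indicator (fun _ => (1 : ℂ)) x‖ := hx
          rw [indicator_of_notMem hxS, norm_zero] at h2
          exact lt_asymm h2 hs
        · have h2 : {x | s < ‖S.indicator (fun _ => (1 : ℂ)) x‖} = ∅ := by
            refine eq_empty_of_forall_notMem fun x hx => h1 ?_
            have h3 : s < ‖S.indicator (fun _ => (1 : ℂ)) x‖ := hx
            refine h3.trans_le ?_
            simpa using norm_indicator_le_norm_self (s := S) (fun _ : X => (1 : ℂ)) x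
          rw [distribution, h2, measure_empty, ENNReal.zero_rpow_of_pos hp']
          exact zero_le
    _ = μ S ^ (1 / p) := by
        rw [setLIntegral_indicator measurableSet_Iio, setLIntegral_const]
        rw [inter_comm, Ioi_inter_Iio]
        simp

theorem measure_cos_mem {n k : ℕ} (hk : 1 ≤ k) (ξ : GeodesicSubsphere n k) (hξ : 0 < ξ.poleCos)
    {B : Set ℝ} (hB : MeasurableSet B) :
    ξ.measure {y | Real.cos (dist0 (ξ.incl y)) ∈ B} =
      sphereConst k * levelMeasure k {u | ξ.poleCos * u ∈ B} := by
  have hi : Measurable ξ.incl := by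
    unfold GeodesicSubsphere.incl
    exact Measurable.subtype_mk (by fun_prop)
  have hm : Measurable fun y => Real.cos (dist0 (ξ.incl y)) := (measurable_cos_dist0 n).comp hi
  have hφ : Measurable (B.indicator (1 : ℝ → ℝ≥0∞)) := measurable_one.indicator hB
  have h1 := ξ.lintegral_measure_cos hk hξ hφ
  rw [← lintegral_levelMeasure k (φ := fun u => B.indicator (1 : ℝ → ℝ≥0∞) (ξ.poleCos * u))
    (by fun_prop)] at h1
  have e1 : (∫⁻ y, B.indicator (1 : ℝ → ℝ≥0∞) (Real.cos (dist0 (ξ.incl y))) ∂ξ.measure) =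
      ξ.measure {y | Real.cos (dist0 (ξ.incl y)) ∈ B} := by
    exact lintegral_indicator_one (hm hB)
  have e2 : (∫⁻ u, B.indicator (1 : ℝ → ℝ≥0∞) (ξ.poleCos * u) ∂levelMeasure k) =
      levelMeasure k {u | ξ.poleCos * u ∈ B} := by
    exact lintegral_indicator_one (measurable_const_mul ξ.poleCos hB)
  rw [← e1, h1, e2]

/-- The endpoint estimate, tested on indicator functions. -/
theorem EndpointEstimate.test {n k : ℕ} (hk : 1 ≤ k) {hkn : k < n} {𝒞 : Set (Sph n → ℂ)}
    (h𝒞 : evenRadialFunctions n ⊆ 𝒞) {α₁ α₂ p γ : ℝ} (hp : 0 < p) (hα : α₁ + n = k * p)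
    (h : EndpointEstimate hkn 𝒞 α₁ α₂ p γ) :
    ∃ C : ℝ≥0∞, C ≠ ∞ ∧ ∀ B : Set ℝ, MeasurableSet B → (∀ t, -t ∈ B ↔ t ∈ B) →
      ∫⁻ t in Ioo (-1 : ℝ) 1 ∩ B,
        ENNReal.ofReal (|t| ^ α₂ * (1 - t ^ 2) ^ (k * p / 2 - 1)) ≠ ∞ →
      ∀ b c : ℝ, 0 ≤ b → b < c → c ≤ 1 → ∃ a ∈ Ioo b c,
        ENNReal.ofReal (a ^ γ) * levelMeasure k {u | a * u ∈ B} ≤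
          C * (∫⁻ t in Ioo (-1 : ℝ) 1 ∩ B,
            ENNReal.ofReal (|t| ^ α₂ * (1 - t ^ 2) ^ (k * p / 2 - 1))) ^ (1 / p) := by
  obtain ⟨C, hC⟩ := h
  have hn : 1 ≤ n := by omega
  have hp' : 0 ≤ 1 / p := by positivity
  have hck0 := sphereConst_ne_zero hk
  have hckt := sphereConst_ne_top k
  refine ⟨(sphereConst k)⁻¹ * (C * (ENNReal.ofReal p * sphereConst n ^ (1 / p))),
    ENNReal.mul_ne_top (ENNReal.inv_ne_top.2 hck0) (ENNReal.mul_ne_top ENNReal.coe_ne_top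
      (ENNReal.mul_ne_top ENNReal.ofReal_ne_top (ENNReal.rpow_ne_top_of_nonneg hp'
        (sphereConst_ne_top n)))), fun B hB hsymm hfin b c hb hbc hc => ?_⟩
  set I := ∫⁻ t in Ioo (-1 : ℝ) 1 ∩ B,
    ENNReal.ofReal (|t| ^ α₂ * (1 - t ^ 2) ^ (k * p / 2 - 1)) with hI
  let S : Set (Sph n) := {x | Real.cos (dist0 x) ∈ B}
  have hS : MeasurableSet S := measurable_cos_dist0 n hB
  let f : Sph n → ℂ := S.indicator fun _ => 1
  have hμS : weightedMeasure n α₁ α₂ S = sphereConst n * I := by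
    rw [hI, ← hα]
    exact weightedMeasure_cos_mem hn α₁ α₂ hB
  have hnorm : lorentzNorm f p 1 (weightedMeasure n α₁ α₂) ≤
      ENNReal.ofReal p * (sphereConst n * I) ^ (1 / p) := by
    rw [← hμS]
    exact lorentzNorm_indicator_one_le _ S hp
  -- The symmetry of `B` makes `f` even, so the same test functions serve both classes.
  have hfC : f ∈ 𝒞 := by
    refine h𝒞 ⟨⟨B.indicator fun _ => 1, fun x => rfl⟩, fun x => ?_⟩
    have : Real.cos (dist0 (-x)) = -Real.cos (dist0 x) := by
      rw [cos_dist0, cos_dist0]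
      simp
    have h1 : -x ∈ S ↔ x ∈ S := by
      change Real.cos (dist0 (-x)) ∈ B ↔ _
      rw [this, hsymm]
      rfl
    by_cases hx : x ∈ S
    · simp only [f, indicator_of_mem hx, indicator_of_mem (h1.2 hx)]
    · simp only [f, indicator_of_notMem hx, indicator_of_notMem (fun h => hx (h1.1 h))]
  have hfL : MemLorentz f p 1 (weightedMeasure n α₁ α₂) := by
    refine ⟨measurable_const.indicator hS, hnorm.trans_lt ?_⟩
    exact ENNReal.mul_lt_top ENNReal.ofReal_lt_top (ENNReal.rpow_lt_top_of_nonneg hp'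
      (ENNReal.mul_ne_top (sphereConst_ne_top n) hfin))
  have h1 := (hC f hfC hfL).2
  rw [eLpNorm_exponent_top] at h1
  have h2 := ae_le_eLpNormEssSup (μ := grassmannMeasure hkn)
    (f := fun ξ => ((Real.cos ξ.dist0 ^ γ : ℝ) : ℂ) * kPlane f ξ)
  obtain ⟨ξ, hξ, hle⟩ := exists_poleCos_mem_Ioo_of_ae hkn h2 hb hbc hc
  have hξ0 : 0 < ξ.poleCos := hb.trans_lt hξ.1
  refine ⟨ξ.poleCos, hξ, ?_⟩
  have h3 : ‖((Real.cos ξ.dist0 ^ γ : ℝ) : ℂ) * kPlane f ξ‖ₑ =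
      ENNReal.ofReal (ξ.poleCos ^ γ) *
        (sphereConst k * levelMeasure k {u | ξ.poleCos * u ∈ B}) := by
    rw [ξ.cos_dist0_eq_poleCos hξ0, enorm_mul]
    congr 1
    · rw [← ofReal_norm, Complex.norm_real, Real.norm_of_nonneg (by positivity)]
    · rw [← measure_cos_mem hk ξ hξ0 hB]
      have hi : Measurable ξ.incl := by
        unfold GeodesicSubsphere.incl
        exact Measurable.subtype_mk (by fun_prop)
      have : IsFiniteMeasure ξ.measure := by
        unfold GeodesicSubsphere.measure
        infer_instance
      have h4 : kPlane f ξ = ∫ y, (ξ.incl ⁻¹' S).indicator (fun _ => (1 : ℂ)) y ∂ξ.measure := rfl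
      rw [h4, integral_indicator_const _ (hi hS), ← ofReal_norm, norm_smul, norm_one, mul_one,
        Real.norm_of_nonneg measureReal_nonneg, ofReal_measureReal]
      rfl
  have h4 := (hle.trans h1).trans (mul_le_mul' le_rfl hnorm)
  rw [h3] at h4
  calc _ = (sphereConst k)⁻¹ * (ENNReal.ofReal (ξ.poleCos ^ γ) *
        (sphereConst k * levelMeasure k {u | ξ.poleCos * u ∈ B})) := by
        rw [show ∀ x y z w : ℝ≥0∞, x * (y * (z * w)) = x * z * (y * w) by intros; ring,
          ENNReal.inv_mul_cancel hck0 hckt, one_mul]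
    _ ≤ (sphereConst k)⁻¹ * (C * (ENNReal.ofReal p * (sphereConst n * I) ^ (1 / p))) := by gcongr
    _ = _ := by
        rw [ENNReal.mul_rpow_of_nonneg _ _ hp']
        ring

theorem rpow_le_two_rpow_abs {x : ℝ} (h1 : 1 / 2 ≤ x) (h2 : x ≤ 2) (β : ℝ) : x ^ β ≤ 2 ^ |β| := by
  have hx : 0 < x := by linarith
  rcases le_total 0 β with h | h
  · rw [abs_of_nonneg h]
    gcongr
  · rw [abs_of_nonpos h, ← inv_inv x, Real.inv_rpow (inv_pos.2 hx).le,
      ← Real.rpow_neg (inv_pos.2 hx).le]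
    have : x⁻¹ ≤ 2 := by
      rw [inv_le_comm₀ hx (by norm_num)]
      linarith
    have h3 : 0 ≤ -β := by linarith
    gcongr

theorem two_rpow_neg_abs_le_rpow {x : ℝ} (h1 : 1 / 2 ≤ x) (h2 : x ≤ 2) (β : ℝ) :
    2 ^ (-|β|) ≤ x ^ β := by
  have hx : 0 < x := by linarith
  have h3 := rpow_le_two_rpow_abs h1 h2 (-β)
  rw [abs_neg, Real.rpow_neg hx.le] at h3
  rw [Real.rpow_neg (by norm_num)]
  exact (inv_le_comm₀ (by positivity) (by positivity)).1 h3

theorem measurableSet_annulus (b c : ℝ) : MeasurableSet {t : ℝ | b ≤ |t| ∧ |t| ≤ c} :=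
  (isClosed_Icc (a := b) (b := c)).measurableSet.preimage measurable_norm

/-- Here `|t|` is comparable to `δ` and `1-t²` to `1`, so both powers are controlled whatever the
signs of the exponents. It is used with `δ → 0`, and with `δ = 1/2` and `c - b → 0`. -/
theorem lintegral_annulus_le (α₂ β : ℝ) {b c δ : ℝ} (hδ0 : 0 < δ) (hδ : δ ≤ 1 / 2)
    (hb : δ / 2 ≤ b) (hbc : b ≤ c) (hc : c ≤ δ) :
    ∫⁻ t in Ioo (-1 : ℝ) 1 ∩ {t | b ≤ |t| ∧ |t| ≤ c},
      ENNReal.ofReal (|t| ^ α₂ * (1 - t ^ 2) ^ β) ≤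
        ENNReal.ofReal (2 ^ |α₂| * 2 ^ |β| * 2 * (δ ^ α₂ * (c - b))) := by
  have hsub : Ioo (-1 : ℝ) 1 ∩ {t | b ≤ |t| ∧ |t| ≤ c} ⊆ Icc b c ∪ Icc (-c) (-b) := by
    rintro t ⟨-, h1, h2⟩
    rcases le_total 0 t with h | h
    · rw [abs_of_nonneg h] at h1 h2
      exact Or.inl ⟨h1, h2⟩
    · rw [abs_of_nonpos h] at h1 h2
      exact Or.inr ⟨by linarith, by linarith⟩
  have hvol : volume (Icc b c ∪ Icc (-c) (-b)) ≤ ENNReal.ofReal (2 * (c - b)) := by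
    refine (measure_union_le _ _).trans_eq ?_
    rw [Real.volume_Icc, Real.volume_Icc, ← ENNReal.ofReal_add (by linarith) (by linarith)]
    congr 1
    ring
  calc _ ≤ ∫⁻ _ in Ioo (-1 : ℝ) 1 ∩ {t | b ≤ |t| ∧ |t| ≤ c},
        ENNReal.ofReal (2 ^ |α₂| * 2 ^ |β| * δ ^ α₂) := by
        refine setLIntegral_mono' (measurableSet_Ioo.inter (measurableSet_annulus b c)) fun t ht => ?_
        obtain ⟨-, h1, h2⟩ := ht
        refine ENNReal.ofReal_le_ofReal ?_
        have e1 : |t| ^ α₂ ≤ 2 ^ |α₂| * δ ^ α₂ := by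
          have : |t| = (|t| / δ) * δ := by field_simp
          rw [this, Real.mul_rpow (by positivity) hδ0.le]
          gcongr
          refine rpow_le_two_rpow_abs ?_ ?_ _
          · rw [le_div_iff₀ hδ0]
            linarith
          · rw [div_le_iff₀ hδ0]
            linarith
        have h4 : t ^ 2 ≤ 1 / 2 := by
          rw [← sq_abs]
          nlinarith [abs_nonneg t]
        have e2 : (1 - t ^ 2) ^ β ≤ 2 ^ |β| :=
          rpow_le_two_rpow_abs (by linarith) (by nlinarith [sq_nonneg t]) _
        calc _ ≤ 2 ^ |α₂| * δ ^ α₂ * 2 ^ |β| := by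
              have : 0 ≤ (1 - t ^ 2) ^ β := Real.rpow_nonneg (by linarith) _
              gcongr
          _ = _ := by ring
    _ ≤ ENNReal.ofReal (2 ^ |α₂| * 2 ^ |β| * δ ^ α₂) * ENNReal.ofReal (2 * (c - b)) := by
        rw [setLIntegral_const]
        gcongr
        exact (measure_mono hsub).trans hvol
    _ = _ := by
        rw [← ENNReal.ofReal_mul (by positivity)]
        congr 1
        ring

theorem exponent_le_of_forall_rpow_le {s t : ℝ} {c C : ℝ≥0∞} (hc : c ≠ 0) (hC : C ≠ ∞)
    (h : ∀ δ : ℝ, 0 < δ → δ ≤ 1 / 4 → c * ENNReal.ofReal (δ ^ s) ≤ C * ENNReal.ofReal (δ ^ t)) :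
    t ≤ s := by
  by_contra! hst
  have hc1 : c ≠ ∞ := by
    rintro rfl
    have h1 := h (1 / 4) (by norm_num) le_rfl
    rw [ENNReal.top_mul (by simpa using Real.rpow_pos_of_pos (by norm_num) s)] at h1
    exact (ENNReal.mul_ne_top hC ENNReal.ofReal_ne_top) (top_le_iff.1 h1)
  lift c to ℝ≥0 using hc1
  lift C to ℝ≥0 using hC
  have hc0 : 0 < (c : ℝ) := by
    have : c ≠ 0 := by simpa using hc
    exact_mod_cast pos_iff_ne_zero.2 this
  -- With `x = 1/δ`, the assumed bound keeps `x^(t-s)` below `C/c`, impossible for large `x` if `s <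
  -- t`.
  have hlim := tendsto_rpow_atTop (sub_pos.2 hst)
  obtain ⟨x, hx1, hx2⟩ := ((hlim.eventually_gt_atTop ((C : ℝ) / c)).and
    (Filter.eventually_ge_atTop (4 : ℝ))).exists
  have hx0 : 0 < x := by linarith
  have h1 := h x⁻¹ (by positivity) (by
    rw [inv_le_comm₀ hx0 (by norm_num)]
    linarith)
  rw [← ENNReal.ofReal_coe_nnreal, ← ENNReal.ofReal_coe_nnreal, ← ENNReal.ofReal_mul (by positivity),
    ← ENNReal.ofReal_mul (by positivity), ENNReal.ofReal_le_ofReal_iff (by positivity),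
    Real.inv_rpow hx0.le, Real.inv_rpow hx0.le] at h1
  rw [Real.rpow_sub hx0, div_lt_div_iff₀ hc0 (by positivity)] at hx1
  have h2 : 0 < x ^ s := by positivity
  have h3 : 0 < x ^ t := by positivity
  have h4 : (c : ℝ) * x ^ t ≤ C * x ^ s := by
    have := mul_le_mul_of_nonneg_right h1 (mul_pos h2 h3).le
    calc (c : ℝ) * x ^ t = c * (x ^ s)⁻¹ * (x ^ s * x ^ t) := by field_simp
      _ ≤ C * (x ^ t)⁻¹ * (x ^ s * x ^ t) := this
      _ = _ := by field_simp
  linarith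

theorem levelMeasure_Icc_ne_zero {k : ℕ} {b c : ℝ} (hb : -1 < b) (hbc : b < c) (hc : c < 1) :
    levelMeasure k (Icc b c) ≠ 0 := by
  have hsub : Icc b c ⊆ Ioo (-1) 1 := fun x hx => ⟨hb.trans_le hx.1, hx.2.trans_lt hc⟩
  rw [levelMeasure_apply k measurableSet_Icc, inter_eq_right.2 hsub]
  refine (setLIntegral_pos_iff (by fun_prop) |>.2 ?_).ne'
  refine lt_of_lt_of_le ?_ (measure_mono (s := Icc b c) fun x hx => ⟨?_, hx⟩)
  · simpa using hbc
  · have := Real.rpow_pos_of_pos (one_sub_sq_pos_of_mem_Ioo (hsub hx)) ((k : ℝ) / 2 - 1)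
    simpa using this

/-- For the annulus `δ/2 ≤ |t| ≤ δ` and `a` comparable to `δ`, the left side is at least a multiple
of `δ^γ` and the right side at most a multiple of `δ^((1+α₂)/p)`. -/
theorem EndpointEstimate.le_gamma {n k : ℕ} (hk : 1 ≤ k) {hkn : k < n} {𝒞 : Set (Sph n → ℂ)}
    (h𝒞 : evenRadialFunctions n ⊆ 𝒞) {α₁ α₂ p γ : ℝ} (hp : 0 < p) (hα : α₁ + n = k * p)
    (h : EndpointEstimate hkn 𝒞 α₁ α₂ p γ) : (1 + α₂) / p ≤ γ := by
  obtain ⟨C, hCt, hC⟩ := h.test hk h𝒞 hp hα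
  have hp' : 0 ≤ 1 / p := by positivity
  set β := k * p / 2 - 1 with hβ
  set M : ℝ := 2 ^ |α₂| * 2 ^ |β| * 2 with hM
  have hM0 : 0 < M := by positivity
  refine exponent_le_of_forall_rpow_le
    -- If `δ < a < 3δ/2` and `1/2 ≤ u ≤ 2/3`, then `au` lies in `[δ/2, δ]`.
    (c := ENNReal.ofReal (2 ^ (-|γ|)) * levelMeasure k (Icc (1 / 2) (2 / 3)))
    (C := C * ENNReal.ofReal M ^ (1 / p)) ?_ ?_ fun δ hδ0 hδ => ?_
  · refine mul_ne_zero ?_ (levelMeasure_Icc_ne_zero (by norm_num) (by norm_num) (by norm_num))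
    have : (0 : ℝ) < 2 ^ (-|γ|) := by positivity
    simpa using this
  · exact ENNReal.mul_ne_top hCt (ENNReal.rpow_ne_top_of_nonneg hp' ENNReal.ofReal_ne_top)
  have hI := lintegral_annulus_le α₂ β (b := δ / 2) (c := δ) hδ0 (by linarith) le_rfl
    (by linarith) le_rfl
  obtain ⟨a, ha, hle⟩ := hC {t | δ / 2 ≤ |t| ∧ |t| ≤ δ} (measurableSet_annulus _ _) (by simp)
    (ne_top_of_le_ne_top ENNReal.ofReal_ne_top hI) δ (3 / 2 * δ) hδ0.le (by linarith)
    (by linarith)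
  have ha0 : 0 < a := hδ0.trans ha.1
  have h1 : ENNReal.ofReal (2 ^ (-|γ|)) * ENNReal.ofReal (δ ^ γ) ≤ ENNReal.ofReal (a ^ γ) := by
    rw [← ENNReal.ofReal_mul (by positivity)]
    refine ENNReal.ofReal_le_ofReal ?_
    have e1 : a = a / δ * δ := by field_simp
    rw [e1, Real.mul_rpow (by positivity) hδ0.le]
    gcongr
    refine two_rpow_neg_abs_le_rpow ?_ ?_ _
    · rw [le_div_iff₀ hδ0]
      linarith [ha.1]
    · rw [div_le_iff₀ hδ0]
      linarith [ha.2]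
  have h2 : Icc (1 / 2 : ℝ) (2 / 3) ⊆ {u | a * u ∈ {t : ℝ | δ / 2 ≤ |t| ∧ |t| ≤ δ}} := by
    intro u hu
    have : 0 < a * u := mul_pos ha0 (by linarith [hu.1])
    change δ / 2 ≤ |a * u| ∧ |a * u| ≤ δ
    rw [abs_of_pos this]
    constructor <;> nlinarith [hu.1, hu.2, ha.1, ha.2]
  have h3 : δ ^ α₂ * (δ - δ / 2) ≤ δ ^ (1 + α₂) := by
    rw [Real.rpow_add hδ0, Real.rpow_one, mul_comm]
    gcongr
    linarith
  calc _ = ENNReal.ofReal (2 ^ (-|γ|)) * ENNReal.ofReal (δ ^ γ) *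
        levelMeasure k (Icc (1 / 2) (2 / 3)) := by ring
    _ ≤ ENNReal.ofReal (a ^ γ) *
        levelMeasure k {u | a * u ∈ {t : ℝ | δ / 2 ≤ |t| ∧ |t| ≤ δ}} := by gcongr
    _ ≤ _ := hle
    _ ≤ C * ENNReal.ofReal (M * δ ^ (1 + α₂)) ^ (1 / p) := by
      gcongr
      exact hI.trans (ENNReal.ofReal_le_ofReal (by gcongr))
    _ = _ := by
      rw [ENNReal.ofReal_mul hM0.le, ENNReal.mul_rpow_of_nonneg _ _ hp',
        ENNReal.ofReal_rpow_of_nonneg (Real.rpow_nonneg hδ0.le _) hp', ← Real.rpow_mul hδ0.le,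
        mul_one_div, mul_assoc]

/-- For `k = 1` the density `(1-u²)^(-1/2)` blows up at `u = 1`. The preimage of the annulus
contains an interval of length at least `ε` within `4ε` of `1`, where the density is at least
`(8ε)^(-1/2)`; the product has order `ε^(1/2)`. -/
theorem ofReal_sqrt_le_levelMeasure_one {ε a : ℝ} (hε0 : 0 < ε) (hε : ε ≤ 1 / 4)
    (ha : a ∈ Ioo (1 / 2) (1 / 2 + ε)) :
    ENNReal.ofReal (8 ^ (-(1 / 2) : ℝ)) * ENNReal.ofReal (ε ^ (1 / 2 : ℝ)) ≤
      levelMeasure 1 {u | a * u ∈ {t : ℝ | 1 / 2 - ε ≤ |t| ∧ |t| ≤ 1 / 2}} := by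
  have ha0 : 0 < a := by linarith [ha.1]
  set J := Icc ((1 / 2 - ε) / a) ((1 / 2) / a) with hJ
  have hJa : ∀ u ∈ J, 1 / 2 - ε ≤ a * u ∧ a * u ≤ 1 / 2 := by
    intro u hu
    have h1 := (div_le_iff₀ ha0).1 hu.1
    have h2 := (le_div_iff₀ ha0).1 hu.2
    constructor <;> linarith
  have hJ1 : J ⊆ Ioo (-1) 1 := by
    intro u hu
    have := hJa u hu
    constructor <;> nlinarith [ha.1]
  have hJsub : J ⊆ {u | a * u ∈ {t : ℝ | 1 / 2 - ε ≤ |t| ∧ |t| ≤ 1 / 2}} := by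
    intro u hu
    have h := hJa u hu
    change 1 / 2 - ε ≤ |a * u| ∧ |a * u| ≤ 1 / 2
    rwa [abs_of_nonneg (by linarith)]
  calc _ = ENNReal.ofReal ((8 * ε) ^ (-(1 / 2) : ℝ)) * ENNReal.ofReal ε := by
        rw [← ENNReal.ofReal_mul (by positivity), ← ENNReal.ofReal_mul (by positivity),
          Real.mul_rpow (by norm_num) hε0.le, mul_assoc]
        congr 2
        nth_rewrite 3 [← Real.rpow_one ε]
        rw [← Real.rpow_add hε0]
        norm_num
    _ ≤ ENNReal.ofReal ((8 * ε) ^ (-(1 / 2) : ℝ)) * volume J := by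
        rw [hJ, Real.volume_Icc]
        gcongr
        rw [← sub_div, le_div_iff₀ ha0]
        nlinarith [ha.2]
    _ = ∫⁻ _ in J, ENNReal.ofReal ((8 * ε) ^ (-(1 / 2) : ℝ)) := by rw [setLIntegral_const]
    _ ≤ ∫⁻ u in J, ENNReal.ofReal ((1 - u ^ 2) ^ (((1 : ℕ) : ℝ) / 2 - 1)) := by
        refine setLIntegral_mono' measurableSet_Icc fun u hu => ?_
        refine ENNReal.ofReal_le_ofReal ?_
        have h1 := one_sub_sq_pos_of_mem_Ioo (hJ1 hu)
        have h2 := hJa u hu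
        have h3 := hJ1 hu
        have h4 : 1 - u ≤ 4 * ε := by nlinarith [ha.1, ha.2, h3.2]
        have h5 : 1 - u ^ 2 ≤ 8 * ε := by nlinarith [h3.1, h3.2]
        have e : ((1 : ℕ) : ℝ) / 2 - 1 = -(1 / 2) := by norm_num
        rw [e]
        exact Real.rpow_le_rpow_of_nonpos h1 h5 (by norm_num)
    _ = levelMeasure 1 J := by
        rw [levelMeasure_apply 1 measurableSet_Icc, inter_eq_right.2 hJ1]
    _ ≤ _ := measure_mono hJsub

/-- The annulus of width `ε` has weighted measure at most a multiple of `ε`, so the estimate bounds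
`ε^(1/2)` by a multiple of `ε^(1/p)` as `ε → 0`. -/
theorem EndpointEstimate.two_le {n : ℕ} {hkn : 1 < n} {𝒞 : Set (Sph n → ℂ)}
    (h𝒞 : evenRadialFunctions n ⊆ 𝒞) {α₁ α₂ p γ : ℝ} (hp : 0 < p) (hα : α₁ + n = p)
    (h : EndpointEstimate hkn 𝒞 α₁ α₂ p γ) : 2 ≤ p := by
  obtain ⟨C, hCt, hC⟩ := h.test le_rfl h𝒞 hp (by simpa using hα)
  have hp' : 0 ≤ 1 / p := by positivity
  set β := ((1 : ℕ) : ℝ) * p / 2 - 1 with hβ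
  set M : ℝ := 2 ^ |α₂| * 2 ^ |β| * 2 * (1 / 2) ^ α₂ with hM
  have hM0 : 0 < M := by positivity
  suffices h' : 1 / p ≤ 1 / 2 from (one_div_le_one_div hp (by norm_num)).1 h'
  refine exponent_le_of_forall_rpow_le
    (c := ENNReal.ofReal (2 ^ (-|γ|)) * ENNReal.ofReal (8 ^ (-(1 / 2) : ℝ)))
    (C := C * ENNReal.ofReal M ^ (1 / p)) ?_ ?_ fun ε hε0 hε => ?_
  · have h1 : (0 : ℝ) < 2 ^ (-|γ|) := by positivity
    have h2 : (0 : ℝ) < 8 ^ (-(1 / 2) : ℝ) := by positivity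
    exact mul_ne_zero (by simpa using h1) (by simpa using h2)
  · exact ENNReal.mul_ne_top hCt (ENNReal.rpow_ne_top_of_nonneg hp' ENNReal.ofReal_ne_top)
  have hI := lintegral_annulus_le α₂ β (b := 1 / 2 - ε) (c := 1 / 2) (δ := 1 / 2) (by norm_num)
    le_rfl (by linarith) (by linarith) le_rfl
  obtain ⟨a, ha, hle⟩ := hC {t | 1 / 2 - ε ≤ |t| ∧ |t| ≤ 1 / 2} (measurableSet_annulus _ _)
    (by simp) (ne_top_of_le_ne_top ENNReal.ofReal_ne_top hI) (1 / 2) (1 / 2 + ε) (by norm_num)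
    (by linarith) (by linarith)
  calc _ = ENNReal.ofReal (2 ^ (-|γ|)) * (ENNReal.ofReal (8 ^ (-(1 / 2) : ℝ)) *
        ENNReal.ofReal (ε ^ (1 / 2 : ℝ))) := mul_assoc _ _ _
    _ ≤ ENNReal.ofReal (a ^ γ) *
        levelMeasure 1 {u | a * u ∈ {t : ℝ | 1 / 2 - ε ≤ |t| ∧ |t| ≤ 1 / 2}} := by
      gcongr
      · exact two_rpow_neg_abs_le_rpow ha.1.le (by linarith [ha.2]) _
      · exact ofReal_sqrt_le_levelMeasure_one hε0 hε ha
    _ ≤ _ := hle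
    _ ≤ C * ENNReal.ofReal (M * ε) ^ (1 / p) := by
      gcongr
      refine hI.trans_eq ?_
      congr 1
      ring
    _ = _ := by
      rw [ENNReal.ofReal_mul hM0.le, ENNReal.mul_rpow_of_nonneg _ _ hp',
        ENNReal.ofReal_rpow_of_nonneg (p := 1 / p) hε0.le hp', mul_assoc]

end SphereKPlane

end

/-! ### The equivalences. -/

theorem mainTheorem9 (n k : ℕ) (hk₁ : 1 ≤ k) (hk : k < n) (α₁ α₂ p γ : ℝ)
    (hα₁ : (k : ℝ) - n ≤ α₁) (hp : p = (α₁ + n) / k) (hpα : 1 + α₂ ≤ p)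
    (hpα' : 0 < α₂ → 1 + α₂ < p) (𝒞 : Set (SphereKPlane.Sph n → ℂ))
    (h𝒞 : 𝒞 = SphereKPlane.radialFunctions n ∨ 𝒞 = SphereKPlane.evenRadialFunctions n) :
    (2 ≤ k → (SphereKPlane.EndpointEstimate hk 𝒞 α₁ α₂ p γ ↔ (1 + α₂) / p ≤ γ)) ∧
    (k = 1 → (SphereKPlane.EndpointEstimate hk 𝒞 α₁ α₂ p γ ↔ (1 + α₂) / p ≤ γ ∧ 2 ≤ p)) := by
  have hk0 : (0 : ℝ) < k := by exact_mod_cast hk₁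
  have hα : α₁ + n = k * p := by
    rw [hp]
    field_simp
  have hp1 : 1 ≤ p := by
    rw [hp, le_div_iff₀ hk0]
    linarith
  have hsub : 𝒞 ⊆ SphereKPlane.radialFunctions n := by
    rcases h𝒞 with rfl | rfl
    · exact subset_rfl
    · exact fun f hf => hf.1
  have hsup : SphereKPlane.evenRadialFunctions n ⊆ 𝒞 := by
    rcases h𝒞 with rfl | rfl
    · exact fun f hf => hf.1
    · exact subset_rfl
  have hp0 : 0 < p := by linarith
  refine ⟨fun hk2 => ⟨fun h => h.le_gamma hk₁ hsup hp0 hα, fun hγ => ?_⟩, ?_⟩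
  · have hk2' : (2 : ℝ) ≤ k := by exact_mod_cast hk2
    -- Since `p ≥ 1`, the condition `kp ≥ 2` is automatic for `k ≥ 2`; for `k = 1` it reads `p ≥ 2`.
    exact SphereKPlane.endpointEstimate_of_le hk₁ hk hsub hp1 hpα hα (by nlinarith) hγ
  · rintro rfl
    refine ⟨fun h => ⟨h.le_gamma le_rfl hsup hp0 hα, h.two_le hsup hp0 (by simpa using hα)⟩,
      fun h => ?_⟩
    exact SphereKPlane.endpointEstimate_of_le le_rfl hk hsub hp1 hpα hα (by simpa using h.2) h.1
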